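/- Let $\Bbbk$ be an algebraically closed field of characteristic $0$; all rings and fields below are $\Bbbk$-algebras. Let $\Gamma$ be a normal noetherian commutative domain with field of fractions $K$, let $L/K$ be a finite Galois extension with group $G$, let $\bar\Gamma$ be the integral closure of $\Gamma$ in $L$, and let $\mathcal M\subset\operatorname{Aut}_{\Bbbk}L$ be a submonoid which is closed under conjugation by $G$ and separating (elements of $\mathcal M$ with the same restriction to $K$ are equal). Let $L*\mathcal M$ be the skew monoid ring, with $(l_1\varphi_1)(l_2\varphi_2)=l_1\varphi_1(l_2)\,\varphi_1\varphi_2$, and let $\mathcal K=(L*\mathcal M)^G$, where $G$ acts on coefficients and by conjugation on $\mathcal M$. Let $U$ be a Galois order over $\Gamma$: a subring of $\mathcal K$ which contains $\Gamma$ and is finitely generated over it, such that $KU=UK=\mathcal K$, and such that for every finite-dimensional right (respectively left) $K$-subspace $W\subset\mathcal K$ the right (respectively left) $\Gamma$-module $W\cap U$ is finitely generated. For $\mathfrak m,\mathfrak n\in\operatorname{Specm}\Gamma$ choose maximal ideals $\ell_{\mathfrak m},\ell_{\mathfrak n}$ of $\bar\Gamma$ lying over $\mathfrak m,\mathfrak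 n$ and put $$S(\mathfrak m,\mathfrak n)=\{\varphi\in\mathcal M \mid \varphi g_1\ell_{\mathfrak m}=g_2\ell_{\mathfrak n}\text{ for some }g_1,g_2\in G\},$$ $$U(S)=\Big\{\sum_{\varphi}u_\varphi\varphi\in U \;\Big|\; u_\varphi\neq0\Rightarrow\varphi\in S\Big\}.$$ For a $\Gamma$-bimodule (that is, a $\Gamma\otimes_{\Bbbk}\Gamma$-module) $V$ let ${}_{\mathfrak n}\hat V_{\mathfrak m}$ be its completion at the ideal $\mathfrak n\otimes\Gamma+\Gamma\otimes\mathfrak m$, equivalently $\varprojlim_{a,b}V/(\mathfrak n^aV+V\mathfrak m^b)$, and put $$\mathcal A(\mathfrak m,\mathfrak n)=\varinjlim_V {}_{\mathfrak n}\hat V_{\mathfrak m},$$ where $V$ runs over the finitely generated $\Gamma$-subbimodules of $U$. It is a left module over $\hat\Gamma_{\mathfrak n}=\varprojlim_a\Gamma/\mathfrak n^a$, a right module over $\hat\Gamma_{\mathfrak m}$, and a module over the completion of $\Gamma\otimes_{\Bbbk}\Gamma$ at $\mathfrak n\otimes\Gamma+\Gamma\otimes\mathfrak m$. Suppose that $S=S(\mathfrak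 m,\mathfrak n)$ is finite. Then: 1. $\mathcal A(\mathfrak m,\mathfrak n)$ is finitely generated as a module over the completion of $\Gamma\otimes_{\Bbbk}\Gamma$ at $\mathfrak n\otimes\Gamma+\Gamma\otimes\mathfrak m$, as a left $\hat\Gamma_{\mathfrak n}$-module, and as a right $\hat\Gamma_{\mathfrak m}$-module. 2. $\mathcal A(\mathfrak m,\mathfrak n)$ is the completed image of $U(S)$: the bimodule $U(S)$ is finitely generated, the canonical map ${}_{\mathfrak n}\widehat{U(S)}_{\mathfrak m}\to\mathcal A(\mathfrak m,\mathfrak n)$ is surjective, and the image of $U(S)$ itself generates $\mathcal A(\mathfrak m,\mathfrak n)$ both as a left $\hat\Gamma_{\mathfrak n}$-module and as a right $\hat\Gamma_{\mathfrak m}$-module. 3. If $S\neq\varnothing$ (in particular if $\mathfrak n=\mathfrak m$, where $1\in S$), then $\Gamma$ is big in $\mathfrak m$, that is, $\mathcal A(\mathfrak m,\mathfrak m)$ is a finitely generated right $\hat\Gamma_{\mathfrak m}$-module; and there are only finitely many isomorphism classes of simple left $U$-modules $N$ with $N(\mathfrak m)=\{v\in N\mid \mathfrak m^rv=0\text{ for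 some }r\ge0\}\neq0$. -/

import Mathlib

open scoped TensorProduct

noncomputable section

namespace GaloisOrder

section OneSided

variable {A R : Type*} [CommRing A] [Ring R]

/-- `R` as a left `A`-module through a ring homomorphism `j : A → R`. -/
abbrev leftModule (j : A →+* R) : Module A R := Module.compHom R j

/-- `R` as a right `A`-module through a ring homomorphism `j : A → R`, so that
`op a • x = x * j a`. -/
abbrev rightModule (j : A →+* R) : Module Aᵐᵒᵖ R := Module.compHom R (RingHom.op j)

/-- The additive subgroup `W` of `R` is a finitely generated left `A`-submodule. -/
def IsLeftFG (j : A →+* R) (W : AddSubgroup R) : Prop :=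
  letI := leftModule j
  ∃ P : Submodule A R, P.FG ∧ P.toAddSubgroup = W

/-- The additive subgroup `W` of `R` is a finitely generated right `A`-submodule. -/
def IsRightFG (j : A →+* R) (W : AddSubgroup R) : Prop :=
  letI := rightModule j
  ∃ P : Submodule Aᵐᵒᵖ R, P.FG ∧ P.toAddSubgroup = W

end OneSided

/-! ### Galois rings and Galois orders -/

section GaloisRing

variable {k L : Type*} [Field k] [Field L] [Algebra k L]

/-- The embedding `a ↦ a · e` of a `k`-algebra `A` that maps to `L` into the skew monoid ring
`L * M`. -/
def coeffEmb (A : Type*) [CommRing A] [Algebra k A] [Algebra A L] [IsScalarTower k A L]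
    (M : Submonoid (L ≃ₐ[k] L)) : A →ₐ[k] SkewMonoidAlgebra L M where
  __ := (SkewMonoidAlgebra.singleOneRingHom (k := L) (G := M)).comp (algebraMap A L)
  commutes' r := by
    change SkewMonoidAlgebra.single (1 : M) (algebraMap A L (algebraMap k A r)) = _
    rw [← IsScalarTower.algebraMap_apply k A L]
    rfl

lemma coeffEmb_apply (A : Type*) [CommRing A] [Algebra k A] [Algebra A L] [IsScalarTower k A L]
    (M : Submonoid (L ≃ₐ[k] L)) (a : A) :
    coeffEmb A M a = SkewMonoidAlgebra.single 1 (algebraMap A L a) := rfl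

variable (K : Type*) [Field K] [Algebra K L] [Algebra k K] [IsScalarTower k K L]

/-- `M` is closed under conjugation by the Galois group of `L / K`. -/
def ConjClosed (M : Submonoid (L ≃ₐ[k] L)) : Prop :=
  ∀ g : L ≃ₐ[K] L, ∀ φ ∈ M, g.restrictScalars k * φ * (g.restrictScalars k)⁻¹ ∈ M

/-- Elements of `M` are determined by their restriction to `K`. -/
def Separating (M : Submonoid (L ≃ₐ[k] L)) : Prop :=
  ∀ φ ∈ M, ∀ ψ ∈ M,
    (∀ x : K, φ (algebraMap K L x) = ψ (algebraMap K L x)) → φ = ψ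

/-- The invariants `(L * M)^G`, `G = Gal(L / K)`: the group acts on coefficients and by
conjugation on `M`, so `x` is invariant iff `x_{g φ g⁻¹} = g (x_φ)`. -/
def invariants (M : Submonoid (L ≃ₐ[k] L)) : Submodule k (SkewMonoidAlgebra L M) where
  carrier := {x | ∀ (g : L ≃ₐ[K] L) (φ ψ : M),
    (ψ : L ≃ₐ[k] L) = g.restrictScalars k * φ * (g.restrictScalars k)⁻¹ →
      x.coeff ψ = g (x.coeff φ)}
  add_mem' {x y} hx hy g φ ψ h := by
    simp [hx g φ ψ h, hy g φ ψ h]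
  zero_mem' g φ ψ h := by simp
  smul_mem' c x hx g φ ψ h := by
    have hc : g (algebraMap k L c) = algebraMap k L c := (g.restrictScalars k).commutes c
    have key : ∀ χ : M, (c • x).coeff χ = algebraMap k L c * x.coeff χ := fun χ => by
      rw [Algebra.smul_def]
      exact SkewMonoidAlgebra.coeff_single_one_mul x (algebraMap k L c) χ
    rw [key, key, map_mul, hc, hx g φ ψ h]

variable (Γ : Type*) [CommRing Γ] [Algebra k Γ] [Algebra Γ L] [IsScalarTower k Γ L]

/-- `U` is a Galois ring over `Γ`: a subring of the invariants `𝒦 = (L * M)^G` containing `Γ`,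
finitely generated over `Γ`, with `K U = U K = 𝒦`. -/
structure IsGaloisRing (M : Submonoid (L ≃ₐ[k] L))
    (U : Subalgebra k (SkewMonoidAlgebra L M)) : Prop where
  base_le : (coeffEmb Γ M).range ≤ U
  le_invariants : Subalgebra.toSubmodule U ≤ invariants K M
  fg : ∃ F : Finset (SkewMonoidAlgebra L M),
    U = Algebra.adjoin k (Set.range (coeffEmb Γ M) ∪ (F : Set (SkewMonoidAlgebra L M)))
  left_span : Subalgebra.toSubmodule (coeffEmb K M).range * Subalgebra.toSubmodule U =
    invariants K M
  right_span : Subalgebra.toSubmodule U * Subalgebra.toSubmodule (coeffEmb K M).range =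
    invariants K M

/-- `U` is a Galois order over `Γ`: a Galois ring meeting every finite-dimensional right
(left) `K`-subspace of `𝒦` in a finitely generated right (left) `Γ`-module. -/
structure IsGaloisOrder (M : Submonoid (L ≃ₐ[k] L))
    (U : Subalgebra k (SkewMonoidAlgebra L M)) : Prop extends IsGaloisRing K Γ M U where
  right_order : ∀ W : AddSubgroup (SkewMonoidAlgebra L M),
    W ≤ (invariants K M).toAddSubgroup → IsRightFG (coeffEmb K M : K →+* _) W →
      IsRightFG (coeffEmb Γ M : Γ →+* _) (W ⊓ (Subalgebra.toSubmodule U).toAddSubgroup)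
  left_order : ∀ W : AddSubgroup (SkewMonoidAlgebra L M),
    W ≤ (invariants K M).toAddSubgroup → IsLeftFG (coeffEmb K M : K →+* _) W →
      IsLeftFG (coeffEmb Γ M : Γ →+* _) (W ⊓ (Subalgebra.toSubmodule U).toAddSubgroup)

variable {K Γ} in
/-- The embedding of `Γ` into a Galois ring. -/
def IsGaloisRing.incl {M : Submonoid (L ≃ₐ[k] L)} {U : Subalgebra k (SkewMonoidAlgebra L M)}
    (hU : IsGaloisRing K Γ M U) : Γ →ₐ[k] U :=
  (coeffEmb Γ M).codRestrict U fun γ => hU.base_le ⟨γ, rfl⟩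

variable {Γ} in
/-- The image in `L` of a maximal ideal of the integral closure of `Γ` in `L`. -/
def idealSet (ℓ : MaximalSpectrum (integralClosure Γ L)) : Set L :=
  (fun x : integralClosure Γ L => (x : L)) '' (ℓ.asIdeal : Set (integralClosure Γ L))

variable {Γ} in
/-- For `ℓm`, `ℓn` lying over `m`, `n`, the set
`S(m, n) = {φ ∈ M | φ g₁ ℓm = g₂ ℓn for some g₁, g₂ ∈ Gal(L / K)}`. -/
def linkSet (M : Submonoid (L ≃ₐ[k] L)) (ℓm ℓn : MaximalSpectrum (integralClosure Γ L)) :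
    Set M :=
  {φ | ∃ g₁ g₂ : L ≃ₐ[K] L, (φ : L ≃ₐ[k] L) '' (g₁ '' idealSet ℓm) = g₂ '' idealSet ℓn}

end GaloisRing

/-! ### The category `𝒜` attached to a commutative subalgebra -/

section Category

variable {k Γ U : Type*} [Field k] [CommRing Γ] [Algebra k Γ] [Ring U] [Algebra k U]

/-- Right multiplication by elements of `Γ`, as a homomorphism since `Γ` is commutative. -/
def rightMulHom (i : Γ →ₐ[k] U) : Γ →ₐ[k] Module.End k U :=
  AlgHom.ofLinearMap ((LinearMap.mul k U).flip ∘ₗ i.toLinearMap)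
    (by ext x; simp)
    (by intro x y; ext u; simp [← mul_assoc, mul_comm x y])

/-- The action of `Γ ⊗ Γ` on `U`, with `γ ⊗ δ` acting as `u ↦ γ u δ`. -/
def bimoduleHom (i : Γ →ₐ[k] U) : Γ ⊗[k] Γ →ₐ[k] Module.End k U :=
  Algebra.TensorProduct.lift ((Algebra.lmul k U).comp i) (rightMulHom i)
    (by intro x y; ext u; simp [rightMulHom, mul_assoc])

lemma bimoduleHom_tmul (i : Γ →ₐ[k] U) (γ δ : Γ) (u : U) :
    bimoduleHom i (γ ⊗ₜ δ) u = i γ * u * i δ := by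
  simp [bimoduleHom, rightMulHom, mul_assoc]

/-- `U` regarded as a `Γ`-bimodule, that is, as a `Γ ⊗ Γ`-module. -/
@[nolint unusedArguments]
def Bimod (_ : Γ →ₐ[k] U) : Type _ := U

variable (i : Γ →ₐ[k] U)

instance : AddCommGroup (Bimod i) := inferInstanceAs (AddCommGroup U)

instance : Module (Γ ⊗[k] Γ) (Bimod i) :=
  letI : Module (Module.End k U) (Bimod i) := inferInstanceAs (Module (Module.End k U) U)
  Module.compHom (Bimod i) (bimoduleHom i : Γ ⊗[k] Γ →+* Module.End k U)

/-- The identity map from `U` as a bimodule to `U`. -/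
def Bimod.toRing : Bimod i ≃+ U := AddEquiv.refl U

variable {i} in
lemma Bimod.toRing_tmul_smul (γ δ : Γ) (u : Bimod i) :
    Bimod.toRing i ((γ ⊗ₜ[k] δ : Γ ⊗[k] Γ) • u) = i γ * Bimod.toRing i u * i δ :=
  bimoduleHom_tmul i γ δ u

/-- The ideal `I = n ⊗ Γ + Γ ⊗ m` of `Γ ⊗ Γ`. -/
def biIdeal (k : Type*) [Field k] {Γ : Type*} [CommRing Γ] [Algebra k Γ]
    (m n : MaximalSpectrum Γ) : Ideal (Γ ⊗[k] Γ) :=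
  n.asIdeal.map (Algebra.TensorProduct.includeLeft : Γ →ₐ[k] Γ ⊗[k] Γ) ⊔
    m.asIdeal.map (Algebra.TensorProduct.includeRight : Γ →ₐ[k] Γ ⊗[k] Γ)

/-- The completion of `Γ ⊗ Γ` at `I = n ⊗ Γ + Γ ⊗ m`. -/
abbrev BiCompletion (k : Type*) [Field k] {Γ : Type*} [CommRing Γ] [Algebra k Γ]
    (m n : MaximalSpectrum Γ) : Type _ :=
  AdicCompletion (biIdeal k m n) (Γ ⊗[k] Γ)

/-- The poset of finitely generated subbimodules of `U`. -/
abbrev FGSub : Type _ := {V : Submodule (Γ ⊗[k] Γ) (Bimod i) // V.FG}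

instance : DecidableEq (FGSub i) := Classical.decEq _

/-- The morphism space `𝒜(m, n)`: the direct limit, over the finitely generated subbimodules
`V` of `U`, of the `(n ⊗ Γ + Γ ⊗ m)`-adic completions of `V`. -/
def HomSpace (m n : MaximalSpectrum Γ) : Type _ :=
  Module.DirectLimit (R := BiCompletion k m n) (ι := FGSub i)
    (fun V => AdicCompletion (biIdeal k m n) V.1)
    (fun _ _ h => AdicCompletion.map (biIdeal k m n) (Submodule.inclusion h))

instance (m n : MaximalSpectrum Γ) : AddCommGroup (HomSpace i m n) :=
  inferInstanceAs (AddCommGroup (Module.DirectLimit (R := BiCompletion k m n) (ι := FGSub i)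
    (fun V => AdicCompletion (biIdeal k m n) V.1)
    (fun _ _ h => AdicCompletion.map (biIdeal k m n) (Submodule.inclusion h))))

instance (m n : MaximalSpectrum Γ) : Module (BiCompletion k m n) (HomSpace i m n) :=
  inferInstanceAs (Module (BiCompletion k m n)
    (Module.DirectLimit (R := BiCompletion k m n) (ι := FGSub i)
    (fun V => AdicCompletion (biIdeal k m n) V.1)
    (fun _ _ h => AdicCompletion.map (biIdeal k m n) (Submodule.inclusion h))))

/-- The canonical map to `𝒜(m, n)` from the completion of a finitely generated subbimodule. -/
def HomSpace.of (m n : MaximalSpectrum Γ) (V : FGSub i) :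
    AdicCompletion (biIdeal k m n) V.1 →ₗ[BiCompletion k m n] HomSpace i m n :=
  Module.DirectLimit.of (BiCompletion k m n) (FGSub i)
    (fun V => AdicCompletion (biIdeal k m n) V.1)
    (fun _ _ h => AdicCompletion.map (biIdeal k m n) (Submodule.inclusion h)) V

/-- The image of `u ∈ U` in `𝒜(m, n)`. -/
def HomSpace.ofElem (m n : MaximalSpectrum Γ) (u : Bimod i) : HomSpace i m n :=
  HomSpace.of i m n ⟨Submodule.span _ {u}, Submodule.fg_span (Set.finite_singleton u)⟩
    (AdicCompletion.of (biIdeal k m n) _ ⟨u, Submodule.mem_span_singleton_self u⟩)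

/-- A ring homomorphism taking `I` into `J` induces a homomorphism of adic completions. -/
def completionMap {A B : Type*} [CommRing A] [CommRing B] (I : Ideal A) (J : Ideal B)
    (f : A →+* B) (h : I ≤ J.comap f) : AdicCompletion I A →+* AdicCompletion J B :=
  AdicCompletion.liftRingHom J
    (fun a => (Ideal.quotientMap (J ^ a) f
      ((Ideal.pow_right_mono h a).trans (Ideal.le_comap_pow f a))).comp
        (AdicCompletion.evalₐ I a : AdicCompletion I A →+* A ⧸ I ^ a))
    (by
      intro a b hab
      ext x
      obtain ⟨z, rfl⟩ := AdicCompletion.mk_surjective I A x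
      have hz : z.val a - z.val b ∈ I ^ a := by
        have h1 := z.property hab
        rwa [SModEq.sub_mem, smul_eq_mul, Ideal.mul_top] at h1
      simp only [RingHom.comp_apply, RingHom.coe_coe, AdicCompletion.evalₐ_mk,
        Ideal.quotientMap_mk]
      change Ideal.Quotient.mk (J ^ a) (f (z.val b)) = Ideal.Quotient.mk (J ^ a) (f (z.val a))
      rw [eq_comm, Ideal.Quotient.eq, ← map_sub]
      exact Ideal.le_comap_pow f a (Ideal.pow_right_mono h a hz))

/-- `Γ̂_n → (Γ ⊗ Γ)^`, induced by `γ ↦ γ ⊗ 1`. -/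
def leftHom (k : Type*) [Field k] {Γ : Type*} [CommRing Γ] [Algebra k Γ]
    (m n : MaximalSpectrum Γ) : AdicCompletion n.asIdeal Γ →+* BiCompletion k m n :=
  completionMap n.asIdeal (biIdeal k m n)
    ((Algebra.TensorProduct.includeLeft : Γ →ₐ[k] Γ ⊗[k] Γ) : Γ →+* Γ ⊗[k] Γ)
    (Ideal.le_comap_of_map_le le_sup_left)

/-- `Γ̂_m → (Γ ⊗ Γ)^`, induced by `γ ↦ 1 ⊗ γ`. -/
def rightHom (k : Type*) [Field k] {Γ : Type*} [CommRing Γ] [Algebra k Γ]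
    (m n : MaximalSpectrum Γ) : AdicCompletion m.asIdeal Γ →+* BiCompletion k m n :=
  completionMap m.asIdeal (biIdeal k m n)
    ((Algebra.TensorProduct.includeRight : Γ →ₐ[k] Γ ⊗[k] Γ) : Γ →+* Γ ⊗[k] Γ)
    (Ideal.le_comap_of_map_le le_sup_right)

/-- `𝒜(m, n)` as a left `Γ̂_n`-module. -/
instance (m n : MaximalSpectrum Γ) :
    Module (AdicCompletion n.asIdeal Γ) (HomSpace i m n) :=
  Module.compHom (HomSpace i m n) (leftHom k m n)

/-- `𝒜(m, n)` as a right `Γ̂_m`-module. -/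
instance (m n : MaximalSpectrum Γ) :
    Module (AdicCompletion m.asIdeal Γ)ᵐᵒᵖ (HomSpace i m n) :=
  Module.compHom (HomSpace i m n)
    ((rightHom k m n).comp
      ((RingEquiv.toOpposite (AdicCompletion m.asIdeal Γ)).symm : _ →+* _))

/-- `Γ` is big in `m`: `𝒜(m, m)` is finitely generated as a right `Γ̂_m`-module. -/
def IsBig (m : MaximalSpectrum Γ) : Prop :=
  Module.Finite (AdicCompletion m.asIdeal Γ)ᵐᵒᵖ (HomSpace i m m)

/-- The `m`-component `M(m) = {v | m ^ r v = 0 for some r}` of a `U`-module `M` is nonzero. -/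
def HasWeight (m : MaximalSpectrum Γ) (M : Type*) [AddCommGroup M] [Module U M] : Prop :=
  ∃ v : M, v ≠ 0 ∧ ∃ r : ℕ, ∀ γ ∈ m.asIdeal ^ r, i γ • v = 0

end Category

/-! ### Elements of a Galois ring with prescribed support -/

section Support

variable {k L : Type*} [Field k] [Field L] [Algebra k L]
  {K : Type*} [Field K] [Algebra K L] [Algebra k K] [IsScalarTower k K L]
  {Γ : Type*} [CommRing Γ] [Algebra k Γ] [Algebra Γ L] [IsScalarTower k Γ L]
  {M : Submonoid (L ≃ₐ[k] L)} {U : Subalgebra k (SkewMonoidAlgebra L M)}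

/-- The subbimodule `U(S) = {u ∈ U | supp u ⊆ S}` of a Galois ring `U`. -/
def supportSub (hU : IsGaloisRing K Γ M U) (S : Set M) :
    Submodule (Γ ⊗[k] Γ) (Bimod hU.incl) where
  carrier := {u | ∀ φ : M,
    (Bimod.toRing hU.incl u : SkewMonoidAlgebra L M).coeff φ ≠ 0 → φ ∈ S}
  add_mem' {x y} hx hy φ h := by
    by_contra hφ
    have h1 := not_imp_not.mpr (hx φ) hφ
    have h2 := not_imp_not.mpr (hy φ) hφ
    simp_all
  zero_mem' φ h := by simp at h
  smul_mem' c x hx := by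
    induction c using TensorProduct.induction_on with
    | zero => intro φ h; simp at h
    | add a b ha hb =>
      intro φ h
      by_contra hφ
      have h1 := not_imp_not.mpr (ha φ) hφ
      have h2 := not_imp_not.mpr (hb φ) hφ
      rw [add_smul] at h
      simp_all
    | tmul γ δ =>
      intro φ h
      rw [Bimod.toRing_tmul_smul] at h
      refine hx φ fun h0 => h ?_
      change (SkewMonoidAlgebra.single (1 : M) (algebraMap Γ L γ) *
        (Bimod.toRing hU.incl x : SkewMonoidAlgebra L M) *
        SkewMonoidAlgebra.single (1 : M) (algebraMap Γ L δ)).coeff φ = 0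
      rw [SkewMonoidAlgebra.coeff_mul_single_one, SkewMonoidAlgebra.coeff_single_one_mul, h0]
      simp

end Support

end GaloisOrder

end

/-! Write `I = n ⊗ Γ + Γ ⊗ m`. On the coefficient at `φ`, `Γ ⊗ Γ` acts through the scalar `γ ⊗ δ ↦ γ
φ(δ)`. The order condition forces `φ` and `φ⁻¹` to preserve the integral closure of `Γ` in `L`, so
lying over and transitivity of the Galois group show that the kernel of this action is comaximal
with `I` unless `φ ∈ S(m, n)` (`ker_twistHom_sup_biIdeal`). A finitely generated subbimodule has
finite support, so a product of elements of such kernels gives an `f ∈ 1 + I` that moves it into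
`U(S)` (`exists_smul_mem_supportSub`). Since `f` acts surjectively on `I`-adic completions, the
completion of `U(S)` maps onto `𝒜(m, n)` (`HomSpace.of_surjective`).

For finite `S` the order condition makes `U(S)` finitely generated over `Γ` on each side. Its
generators still generate the completion over `Γ̂`: although the `I`-adic filtration need not be the
one-sided one, a Mittag-Leffler argument over Artinian quotients lifts coefficients
(`exists_sum_completionMap_smul`).

A simple module with nonzero `m`-component is a quotient of `U / U m`. There, by Nakayama, every
element splits into an `m`-torsion part and a complement (`exists_split_mod_weightIdeal`), and the
torsion comes from `U(S(m, m))` (`exists_sub_mem_weightSub`), so it is finitely generated over `Γ`,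
hence Artinian. The descending chain condition on this torsion bounds the simple quotients
(`exists_finset_quotient_equiv`). Finiteness of `S(m, m)` follows from that of a nonempty `S(m, n)`
by translation (`finite_linkSet_self`). -/

/-! ### Mittag-Leffler and generators of completions -/

/-- A Noetherian module killed by a power of a maximal ideal is Artinian. -/
theorem isArtinian_of_pow_smul_eq_zero {R : Type*} [CommRing R] (m : Ideal R) [hm : m.IsMaximal]
    (c : ℕ) {X : Type*} [AddCommGroup X] [Module R X] [IsNoetherian R X]
    (h : ∀ γ ∈ m ^ c, ∀ x : X, γ • x = 0) : IsArtinian R X := by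
  induction c generalizing X with
  | zero =>
    have : Subsingleton X := ⟨fun a b => by
      rw [← one_smul R a, ← one_smul R b, h 1 (by simp), h 1 (by simp)]⟩
    infer_instance
  | succ c ih =>
    let Y : Submodule R X := m • ⊤
    have hY : IsArtinian R Y := by
      apply ih
      rintro γ hγ ⟨y, hy⟩
      ext
      change γ • y = 0
      induction hy using Submodule.smul_induction_on' with
      | smul a ha x _ => rw [smul_smul]; exact h _ (by rw [pow_succ]; exact Ideal.mul_mem_mul hγ ha) x
      | add x _ y _ hx hy => rw [smul_add, hx, hy, add_zero]
    have hQ : IsArtinian R (X ⧸ Y) := by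
      let : Field (R ⧸ m) := Ideal.Quotient.field m
      let : Module (R ⧸ m) (X ⧸ Y) := Module.instQuotientIdealSubmoduleHSMulTop X m
      have : Module.Finite (R ⧸ m) (X ⧸ Y) := Module.Finite.of_restrictScalars_finite R _ _
      have : IsArtinian (R ⧸ m) (X ⧸ Y) := inferInstance
      exact isArtinian_of_surjective_algebraMap (S := R) (R := R ⧸ m) Ideal.Quotient.mk_surjective
    exact isArtinian_of_range_eq_ker Y.subtype Y.mkQ (by simp)

theorem apply_mem_of_mem_smul_top {R ι : Type*} [CommRing R] {J : Ideal R} {d : ι → R}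
    (hd : d ∈ J • (⊤ : Submodule R (ι → R))) (j : ι) : d j ∈ J := by
  induction hd using Submodule.smul_induction_on' with
  | smul a ha x _ => exact J.mul_mem_right _ ha
  | add x _ y _ hx hy => exact J.add_mem hx hy

/-- Mittag-Leffler condition for a descending chain of submodules of `R ^ ι`, relative to the
powers of a maximal ideal. -/
theorem exists_stable_mod_pow {R ι : Type*} [CommRing R] [IsNoetherianRing R] [Finite ι]
    (n : Ideal R) [n.IsMaximal] (N : ℕ → Submodule R (ι → R)) (hN : Antitone N) (a : ℕ) :
    ∃ b, ∀ b₁ ≥ b, ∀ b₂, ∀ d ∈ N b₁, ∃ d' ∈ N b₂, ∀ j, d j - d' j ∈ n ^ a := by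
  let Y : Submodule R (ι → R) := n ^ a • ⊤
  have hA : IsArtinian R ((ι → R) ⧸ Y) := by
    refine isArtinian_of_pow_smul_eq_zero n a fun γ hγ x => ?_
    obtain ⟨x, rfl⟩ := Submodule.Quotient.mk_surjective _ x
    rw [← Submodule.Quotient.mk_smul, Submodule.Quotient.mk_eq_zero]
    exact Submodule.smul_mem_smul hγ trivial
  -- The images of the chain in the Artinian module `R ^ ι / n ^ a R ^ ι` become stationary.
  obtain ⟨b, hb⟩ := IsArtinian.monotone_stabilizes
    (⟨fun b => OrderDual.toDual ((N b).map Y.mkQ), fun x y h => Submodule.map_mono (hN h)⟩ :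
      ℕ →o (Submodule R ((ι → R) ⧸ Y))ᵒᵈ)
  refine ⟨b, fun b₁ h₁ b₂ d hd => ?_⟩
  have h2 : (N b).map Y.mkQ = (N (max b b₂)).map Y.mkQ :=
    OrderDual.toDual.injective (hb _ (le_max_left _ _))
  have h3 : Y.mkQ d ∈ (N (max b b₂)).map Y.mkQ := by
    rw [← h2]; exact Submodule.mem_map_of_mem (hN h₁ hd)
  obtain ⟨d', hd', h4⟩ := h3
  refine ⟨d', hN (le_max_right _ _) hd', fun j => ?_⟩
  have h5 : d - d' ∈ Y := (Submodule.Quotient.eq _).1 h4.symm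
  exact apply_mem_of_mem_smul_top h5 j

open GaloisOrder in
/-- If `V` is generated over a Noetherian ring `R` by finitely many elements, then they generate
the `I`-adic completion of `V` over the `n`-adic completion of `R`, for every ideal `I` of an
`R`-algebra acting on `V` that contains the image of the maximal ideal `n`. -/
theorem exists_sum_completionMap_smul {R A V ι : Type*} [CommRing R] [IsNoetherianRing R]
    [CommRing A] [AddCommGroup V] [Module A V] [Fintype ι] (n : Ideal R) [n.IsMaximal]
    (I : Ideal A) (f : R →+* A) (h : n ≤ I.comap f) (v : ι → V)
    (hv : ∀ x, ∃ c : ι → R, x = ∑ j, f (c j) • v j) (x : AdicCompletion I V) :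
    ∃ c : ι → AdicCompletion n R,
      x = ∑ j, completionMap n I f h (c j) • AdicCompletion.of I V (v j) := by
  classical
  let p : (ι → R) → V := fun c => ∑ j, f (c j) • v j
  have p_add (c d) : p (c + d) = p c + p d := by
    simp [p, add_smul, Finset.sum_add_distrib]
  have p_sub (c d) : p (c - d) = p c - p d := by
    simp [p, sub_smul, Finset.sum_sub_distrib]
  -- `N a` measures the ambiguity in lifting an element of `V / I ^ a V` to a coefficient vector.
  let N : ℕ → Submodule R (ι → R) := fun a =>
    { carrier := {c | p c ∈ (I ^ a • ⊤ : Submodule A V)}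
      add_mem' := fun {c d} hc hd => by
        change p (c + d) ∈ (I ^ a • ⊤ : Submodule A V)
        rw [p_add]; exact add_mem hc hd
      zero_mem' := by simp [p]
      smul_mem' := fun r c hc => by
        have : p (r • c) = f r • p c := by simp [p, Finset.smul_sum, mul_smul]
        change p (r • c) ∈ (I ^ a • ⊤ : Submodule A V)
        rw [this]; exact Submodule.smul_mem _ _ hc }
  have hN : Antitone N := fun a b hab c hc =>
    Submodule.smul_mono_left (Ideal.pow_le_pow_right hab) hc
  choose b hb using exists_stable_mod_pow n N hN
  -- A monotone choice of levels with `a ≤ B a` and `b a ≤ B a`: the `a`-th coefficient vector must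
  -- be correct modulo `I ^ B a`, so that it can be corrected later by changes in `n ^ a` only.
  let B : ℕ → ℕ := fun a => a + ∑ i ∈ Finset.range (a + 1), b i
  have hbB (a) : b a ≤ B a :=
    (Finset.single_le_sum (f := b) (fun _ _ => Nat.zero_le _) (Finset.self_mem_range_succ a)).trans
      (Nat.le_add_left _ _)
  have hB (a) : B a ≤ B (a + 1) := by
    simp only [B, Finset.sum_range_succ _ (a + 1)]; lia
  let P : ℕ → (ι → R) → Prop := fun a c => Submodule.Quotient.mk (p c) = x.val (B a)
  have hP (a) : ∃ c, P a c := by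
    obtain ⟨y, hy⟩ := Submodule.Quotient.mk_surjective _ (x.val (B a))
    obtain ⟨c, hc⟩ := hv y
    exact ⟨c, by simp only [P, p, ← hc, hy]⟩
  have trans_eq {a c} {y : V} (hac : a ≤ c) (hy : Submodule.Quotient.mk y = x.val c) :
      Submodule.Quotient.mk y = x.val a := by
    rw [← AdicCompletion.transitionMap_comp_eval_apply I V hac x, ← hy]; rfl
  -- A lift `d` at the next level differs from `c` by an element of `N (B a)`. By stability this
  -- agrees modulo `n ^ a` with some `q ∈ N (B (a + 1))`, and `d - q` is still a lift.
  have step (a c) (hc : P a c) : ∃ c', P (a + 1) c' ∧ ∀ j, c j - c' j ∈ n ^ a := by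
    obtain ⟨d, hd⟩ := hP (a + 1)
    have h1 : d - c ∈ N (B a) := by
      change p (d - c) ∈ (I ^ B a • ⊤ : Submodule A V)
      rw [p_sub]
      exact (Submodule.Quotient.eq _).1 ((trans_eq (hB a) hd).trans hc.symm)
    obtain ⟨q, hq, hq'⟩ := hb a (B a) (hbB a) (B (a + 1)) _ h1
    refine ⟨d - q, ?_, fun j => ?_⟩
    · change Submodule.Quotient.mk (p (d - q)) = x.val (B (a + 1))
      rw [← hd, p_sub]
      refine (Submodule.Quotient.eq _).2 ?_
      rw [sub_sub_cancel_left]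
      exact neg_mem hq
    · have := neg_mem (hq' j)
      simp only [Pi.sub_apply] at this ⊢
      convert this using 1
      ring
  let s : ∀ a, {c // P a c} := fun a => Nat.rec ⟨(hP 0).choose, (hP 0).choose_spec⟩
    (fun a c => ⟨(step a c.1 c.2).choose, (step a c.1 c.2).choose_spec.1⟩) a
  have hs (a j) : (s a).1 j - (s (a + 1)).1 j ∈ n ^ a :=
    (step a (s a).1 (s a).2).choose_spec.2 j
  let C : ι → AdicCompletion.AdicCauchySequence n R := fun j =>
    AdicCompletion.AdicCauchySequence.mk n R (fun a => (s a).1 j) fun a => by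
      rw [SModEq.sub_mem, smul_eq_mul, Ideal.mul_top]; exact hs a j
  refine ⟨fun j => AdicCompletion.mk n R (C j), AdicCompletion.ext fun a => ?_⟩
  rw [AdicCompletion.val_sum_apply]
  have h1 (j) : (completionMap n I f h (AdicCompletion.mk n R (C j)) •
      AdicCompletion.of I V (v j)).val a = Submodule.Quotient.mk (f ((s a).1 j) • v j) := rfl
  simp only [h1]
  rw [← trans_eq ((Nat.le_add_right a _).trans le_rfl : a ≤ B a) (s a).2]
  exact map_sum (Submodule.mkQ _) _ _

/-! ### Finiteness of simple quotients -/

/-- A simple quotient by a left ideal that contains a finite intersection of maximal left ideals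
is isomorphic to the quotient by one of these. -/
theorem exists_quotient_equiv_of_inf_le {U : Type*} [Ring U] {P : Submodule U U} (hP : IsCoatom P)
    (T : Finset (Submodule U U)) (hT : ∀ A ∈ T, IsCoatom A) (h : T.inf id ≤ P) :
    ∃ A ∈ T, Nonempty ((U ⧸ P) ≃ₗ[U] U ⧸ A) := by
  classical
  induction T using Finset.induction_on with
  | empty => exact absurd (top_le_iff.1 (by simpa using h)) hP.1
  | insert A T _ ih =>
    by_cases hD : T.inf id ≤ P
    · obtain ⟨B, hB, e⟩ := ih (fun A hA => hT A (Finset.mem_insert_of_mem hA)) hD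
      exact ⟨B, Finset.mem_insert_of_mem hB, e⟩
    · refine ⟨A, Finset.mem_insert_self _ _, ?_⟩
      rw [Finset.inf_insert] at h
      generalize T.inf id = D at h hD
      have hA : IsSimpleModule U (U ⧸ A) :=
        isSimpleModule_iff_isCoatom.2 (hT A (Finset.mem_insert_self _ _))
      have hP' : IsSimpleModule U (U ⧸ P) := isSimpleModule_iff_isCoatom.2 hP
      let f : D →ₗ[U] U ⧸ A := A.mkQ ∘ₗ D.subtype
      let g : D →ₗ[U] U ⧸ P := P.mkQ ∘ₗ D.subtype
      -- `D` maps onto both simple modules, and `A ∩ D ≤ P`; the kernels are then comparable and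
      -- maximal, hence equal.
      have hker : f.ker ≤ g.ker := fun x hx => by
        have hx' : (x : U) ∈ A := (Submodule.Quotient.mk_eq_zero A).1 hx
        exact (Submodule.Quotient.mk_eq_zero P).2 (h ⟨hx', x.2⟩)
      have hg0 : g ≠ 0 := fun h0 => hD fun x hx =>
        (Submodule.Quotient.mk_eq_zero P).1 (LinearMap.congr_fun h0 ⟨x, hx⟩)
      have hf0 : f ≠ 0 := fun h0 => hg0 <| LinearMap.ker_eq_top.1 <| top_le_iff.1 <| by
        rw [← LinearMap.ker_eq_top.2 h0]; exact hker
      have hg := g.surjective_of_ne_zero hg0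
      have hf := f.surjective_of_ne_zero hf0
      have hco : IsCoatom f.ker := isSimpleModule_iff_isCoatom.1
        (IsSimpleModule.congr (f.quotKerEquivOfSurjective hf))
      have heq : g.ker = f.ker := by
        refine (hco.le_iff.1 hker).resolve_left fun h0 => hg0 (LinearMap.ker_eq_top.1 h0)
      exact ⟨(g.quotKerEquivOfSurjective hg).symm ≪≫ₗ Submodule.quotEquivOfEq _ _ heq ≪≫ₗ
        f.quotKerEquivOfSurjective hf⟩

/-- The elements killed by some power of an ideal. -/
def powTorsion {R : Type*} [CommRing R] (m : Ideal R) (X : Type*) [AddCommGroup X] [Module R X] :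
    Submodule R X where
  carrier := {y | ∃ c, ∀ γ ∈ m ^ c, γ • y = 0}
  add_mem' := by
    rintro x y ⟨c, hc⟩ ⟨d, hd⟩
    refine ⟨max c d, fun γ hγ => ?_⟩
    rw [smul_add, hc γ (Ideal.pow_le_pow_right (le_max_left _ _) hγ),
      hd γ (Ideal.pow_le_pow_right (le_max_right _ _) hγ), add_zero]
  zero_mem' := ⟨0, fun _ _ => smul_zero _⟩
  smul_mem' := by
    rintro r x ⟨c, hc⟩
    exact ⟨c, fun γ hγ => by rw [smul_comm, hc γ hγ, smul_zero]⟩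

theorem isArtinian_powTorsion {R : Type*} [CommRing R] (m : Ideal R) [m.IsMaximal] (X : Type*)
    [AddCommGroup X] [Module R X] [IsNoetherian R (powTorsion m X)] :
    IsArtinian R (powTorsion m X) := by
  obtain ⟨S, hS⟩ := (isNoetherian_def.1 ‹IsNoetherian R (powTorsion m X)›) ⊤
  have hc (y : powTorsion m X) : ∃ c, ∀ γ ∈ m ^ c, γ • y = 0 := by
    obtain ⟨y, c, hc⟩ := y
    exact ⟨c, fun γ hγ => Subtype.ext (hc γ hγ)⟩
  choose c hc using hc
  refine isArtinian_of_pow_smul_eq_zero m (S.sup c) fun γ hγ x => ?_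
  have hx : x ∈ Submodule.span R (S : Set (powTorsion m X)) := hS ▸ Submodule.mem_top
  induction hx using Submodule.span_induction with
  | mem x hx => exact hc x γ (Ideal.pow_le_pow_right (Finset.le_sup (f := c) hx) hγ)
  | zero => exact smul_zero _
  | add x y _ _ hx hy => rw [smul_add, hx, hy, add_zero]
  | smul a x _ hx => rw [smul_comm, hx, smul_zero]

/-- Let `J` be a left ideal of `U` containing a maximal ideal `m` of a Noetherian ring `R`, such
that every cyclic `R`-submodule of `U / J` splits off its `m`-component and the `m`-component of
`U / J` is finitely generated. Then `U / J` has finitely many simple quotients up to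
isomorphism. -/
theorem exists_finset_quotient_equiv {R U : Type*} [CommRing R] [IsNoetherianRing R] [Ring U]
    [Module R U] [IsScalarTower R U U] (m : Ideal R) [m.IsMaximal] (J : Submodule U U)
    (hJ : ∀ γ ∈ m, γ • (1 : U) ∈ J)
    (hloc : ∀ u : U, ∃ e : R, e - 1 ∈ m ∧ ∃ c, ∀ γ ∈ m ^ c, γ • e • u ∈ J)
    (F : Submodule R U) (hF : F.FG)
    (htor : ∀ u : U, (∃ c, ∀ γ ∈ m ^ c, γ • u ∈ J) → ∃ w ∈ F, u - w ∈ J) :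
    ∃ s : Finset (Submodule U U), ∀ P : Submodule U U, IsCoatom P → J ≤ P →
      ∃ A ∈ s, Nonempty ((U ⧸ P) ≃ₗ[U] U ⧸ A) := by
  classical
  let q : U →ₗ[R] U ⧸ J := J.mkQ.restrictScalars R
  have hq (u v : U) : q u = q v ↔ u - v ∈ J := Submodule.Quotient.eq J
  have hq0 (u : U) : q u = 0 ↔ u ∈ J := Submodule.Quotient.mk_eq_zero J
  have hle : powTorsion m (U ⧸ J) ≤ F.map q := by
    rintro y ⟨c, hc⟩
    obtain ⟨u, rfl⟩ := J.mkQ_surjective y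
    obtain ⟨w, hw, h⟩ := htor u ⟨c, fun γ hγ => (hq0 _).1 ((q.map_smul γ u).trans (hc γ hγ))⟩
    exact ⟨w, hw, ((hq u w).2 h).symm⟩
  have : IsNoetherian R (F.map q) := isNoetherian_of_fg_of_noetherian _ (hF.map q)
  have : IsNoetherian R (powTorsion m (U ⧸ J)) := isNoetherian_of_le hle
  have hart := isArtinian_powTorsion m (U ⧸ J)
  let S : Set (Finset (Submodule U U)) := {T | ∀ A ∈ T, IsCoatom A ∧ J ≤ A}
  let Y : Finset (Submodule U U) → Submodule R (powTorsion m (U ⧸ J)) := fun T =>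
    (((T.inf id).restrictScalars R).map q).comap (powTorsion m (U ⧸ J)).subtype
  -- Choose `T` whose intersection has minimal trace on the torsion of `U / J`; adding a further `P`
  -- cannot shrink the trace.
  obtain ⟨_, ⟨T, hT, rfl⟩, hmin⟩ :=
    (IsWellFounded.wf : WellFounded ((· < ·) : Submodule R (powTorsion m (U ⧸ J)) → _ → Prop)).has_min
      (Y '' S) ⟨Y ∅, ∅, by simp [S], rfl⟩
  refine ⟨T, fun P hP hJP =>
    exists_quotient_equiv_of_inf_le hP T (fun A hA => (hT A hA).1) ?_⟩
  by_contra hTP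
  have hins : insert P T ∈ S := by
    intro A hA
    rcases Finset.mem_insert.1 hA with rfl | hA
    exacts [⟨hP, hJP⟩, hT A hA]
  have hY : Y T ≤ Y (insert P T) := by
    by_contra h
    refine hmin _ ⟨_, hins, rfl⟩ (lt_of_le_not_ge ?_ h)
    refine Submodule.comap_mono (Submodule.map_mono fun x hx => ?_)
    rw [Submodule.restrictScalars_mem, Finset.inf_insert] at hx
    exact hx.2
  -- Write `1 = p + d` with `d` in the intersection. The torsion class of `e d` lies in the trace,
  -- so `e d ∈ P` by minimality; then `e ∈ P`, and `e - 1 ∈ J ≤ P` gives `1 ∈ P`.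
  have htop : P ⊔ T.inf id = ⊤ := hP.2 _ (left_lt_sup.2 hTP)
  obtain ⟨p, hp, d, hd, hpd⟩ := Submodule.mem_sup.1 (htop ▸ Submodule.mem_top : (1 : U) ∈ _)
  obtain ⟨e, he, c, hc⟩ := hloc d
  have hed : q (e • d) ∈ powTorsion m (U ⧸ J) :=
    ⟨c, fun γ hγ => by rw [← map_smul, hq0]; exact hc γ hγ⟩
  have h1 : (⟨q (e • d), hed⟩ : powTorsion m (U ⧸ J)) ∈ Y T :=
    ⟨e • d, ((T.inf id).restrictScalars R).smul_mem e hd, rfl⟩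
  obtain ⟨d', hd', h2⟩ := hY h1
  rw [SetLike.mem_coe, Submodule.restrictScalars_mem, Finset.inf_insert] at hd'
  have h3 : e • d ∈ P.restrictScalars R := by
    have := add_mem (hJP ((hq _ _).1 h2.symm)) hd'.1
    rwa [sub_add_cancel] at this
  have h4 : e • (1 : U) ∈ P.restrictScalars R := by
    rw [← hpd, smul_add]
    exact add_mem ((P.restrictScalars R).smul_mem e hp) h3
  have h5 : (1 : U) ∈ P := by
    have := sub_mem h4 (show (e - 1) • (1 : U) ∈ P.restrictScalars R from hJP (hJ _ he))
    rwa [← sub_smul, sub_sub_cancel, one_smul] at this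
  exact hP.1 (Ideal.eq_top_of_isUnit_mem (I := P) h5 isUnit_one)

/-! ### Two-sided finiteness of elements with finite support -/

namespace GaloisOrder

section OneSided

variable {A R : Type*} [CommRing A] [Ring R]

theorem IsLeftFG.exists_fin {j : A →+* R} {W : AddSubgroup R} (h : IsLeftFG j W) :
    ∃ (r : ℕ) (s : Fin r → R), (∀ a, s a ∈ W) ∧ ∀ x ∈ W, ∃ c : Fin r → A, x = ∑ a, j (c a) * s a := by
  let := leftModule j
  obtain ⟨P, hP, rfl⟩ := h
  obtain ⟨r, s, rfl⟩ := Submodule.fg_iff_exists_fin_generating_family.1 hP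
  refine ⟨r, s, fun a => Submodule.subset_span ⟨a, rfl⟩, fun x hx => ?_⟩
  obtain ⟨c, hc⟩ := (Submodule.mem_span_range_iff_exists_fun A).1 hx
  exact ⟨c, hc.symm⟩

theorem IsRightFG.exists_fin {j : A →+* R} {W : AddSubgroup R} (h : IsRightFG j W) :
    ∃ (r : ℕ) (s : Fin r → R), (∀ a, s a ∈ W) ∧ ∀ x ∈ W, ∃ c : Fin r → A, x = ∑ a, s a * j (c a) := by
  let := rightModule j
  obtain ⟨P, hP, rfl⟩ := h
  obtain ⟨r, s, rfl⟩ := Submodule.fg_iff_exists_fin_generating_family.1 hP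
  refine ⟨r, s, fun a => Submodule.subset_span ⟨a, rfl⟩, fun x hx => ?_⟩
  obtain ⟨c, hc⟩ := (Submodule.mem_span_range_iff_exists_fun Aᵐᵒᵖ).1 hx
  exact ⟨fun a => (c a).unop, hc.symm⟩

end OneSided

section Skew

variable {k L : Type*} [Field k] [Field L] [Algebra k L] {M : Submonoid (L ≃ₐ[k] L)}

theorem coeff_coeffEmb_mul {A : Type*} [CommRing A] [Algebra k A] [Algebra A L]
    [IsScalarTower k A L] (a : A) (x : SkewMonoidAlgebra L M) (φ : M) :
    (coeffEmb A M a * x).coeff φ = algebraMap A L a * x.coeff φ :=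
  SkewMonoidAlgebra.coeff_single_one_mul x _ φ

theorem coeff_mul_coeffEmb {A : Type*} [CommRing A] [Algebra k A] [Algebra A L]
    [IsScalarTower k A L] (a : A) (x : SkewMonoidAlgebra L M) (φ : M) :
    (x * coeffEmb A M a).coeff φ = x.coeff φ * (φ : L ≃ₐ[k] L) (algebraMap A L a) :=
  SkewMonoidAlgebra.coeff_mul_single_one x _ φ

/-- The coefficient at `φ`, as an additive map. -/
def coeffHom (φ : M) : SkewMonoidAlgebra L M →+ L where
  toFun x := x.coeff φ
  map_zero' := rfl
  map_add' x y := by simp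

theorem coeffHom_apply (φ : M) (x : SkewMonoidAlgebra L M) : coeffHom φ x = x.coeff φ := rfl

variable (K : Type*) [Field K] [Algebra K L] [Algebra k K] [IsScalarTower k K L]

/-- The invariants with support in `T`. -/
def invariantsOn (M : Submonoid (L ≃ₐ[k] L)) (T : Set M) : AddSubgroup (SkewMonoidAlgebra L M) where
  carrier := {x | x ∈ invariants K M ∧ ∀ φ ∉ T, x.coeff φ = 0}
  add_mem' hx hy := ⟨add_mem hx.1 hy.1, fun φ hφ => by simp [hx.2 φ hφ, hy.2 φ hφ]⟩
  zero_mem' := ⟨zero_mem _, fun φ _ => by simp⟩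
  neg_mem' hx := ⟨neg_mem hx.1, fun φ hφ => by simp [hx.2 φ hφ]⟩

variable {K}

theorem coeffEmb_mul_mem_invariants (a : K) {x : SkewMonoidAlgebra L M} (hx : x ∈ invariants K M) :
    coeffEmb K M a * x ∈ invariants K M := by
  intro g φ ψ h
  rw [coeff_coeffEmb_mul, coeff_coeffEmb_mul, hx g φ ψ h, map_mul, AlgEquiv.commutes]

theorem mul_coeffEmb_mem_invariants (a : K) {x : SkewMonoidAlgebra L M} (hx : x ∈ invariants K M) :
    x * coeffEmb K M a ∈ invariants K M := by
  intro g φ ψ h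
  have h1 : (ψ : L ≃ₐ[k] L) (algebraMap K L a) = g ((φ : L ≃ₐ[k] L) (algebraMap K L a)) := by
    rw [h]
    change g ((φ : L ≃ₐ[k] L) (g.symm (algebraMap K L a))) = _
    rw [AlgEquiv.commutes]
  rw [coeff_mul_coeffEmb, coeff_mul_coeffEmb, hx g φ ψ h, map_mul, h1]

/-- Reading off the coefficients at `φ ∈ T` is an injective `K`-linear map to the finite-dimensional
space `L ^ T`. -/
theorem isLeftFG_invariantsOn [FiniteDimensional K L] {T : Set M} (hT : T.Finite) :
    IsLeftFG (coeffEmb K M : K →+* _) (invariantsOn K M T) := by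
  let := leftModule (coeffEmb K M : K →+* SkewMonoidAlgebra L M)
  let P : Submodule K (SkewMonoidAlgebra L M) :=
    { invariantsOn K M T with
      smul_mem' := fun a x hx => ⟨coeffEmb_mul_mem_invariants a hx.1, fun φ hφ =>
        (coeff_coeffEmb_mul a x φ).trans (by rw [hx.2 φ hφ, mul_zero])⟩ }
  refine ⟨P, ?_, rfl⟩
  have := hT.to_subtype
  let e : P →ₗ[K] (T → L) :=
    { toFun := fun x φ => x.1.coeff φ.1
      map_add' := fun x y => by ext; simp
      map_smul' := fun a x => by
        ext φ
        exact (coeff_coeffEmb_mul a x.1 φ.1).trans (Algebra.smul_def a _).symm }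
  refine Module.Finite.iff_fg.1 (Module.Finite.of_injective e fun x y h => ?_)
  ext φ
  by_cases hφ : φ ∈ T
  · exact congr_fun h ⟨φ, hφ⟩
  · rw [x.2.2 φ hφ, y.2.2 φ hφ]

/-- Right multiplication by `a` scales the coefficient at `φ` by `φ(a)`, so the coefficients are
untwisted by `φ⁻¹` to obtain a linear embedding into `L ^ T`. -/
theorem isRightFG_invariantsOn [FiniteDimensional K L] {T : Set M} (hT : T.Finite) :
    IsRightFG (coeffEmb K M : K →+* _) (invariantsOn K M T) := by
  let := rightModule (coeffEmb K M : K →+* SkewMonoidAlgebra L M)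
  let P : Submodule Kᵐᵒᵖ (SkewMonoidAlgebra L M) :=
    { invariantsOn K M T with
      smul_mem' := fun a x hx => ⟨mul_coeffEmb_mem_invariants a.unop hx.1, fun φ hφ =>
        (coeff_mul_coeffEmb a.unop x φ).trans (by rw [hx.2 φ hφ, zero_mul])⟩ }
  refine ⟨P, ?_, rfl⟩
  have := hT.to_subtype
  let : Module Kᵐᵒᵖ L := Module.compHom L ((RingEquiv.toOpposite K).symm : Kᵐᵒᵖ →+* K)
  have : Module.Finite Kᵐᵒᵖ L := by
    obtain ⟨r, s, hs⟩ := Submodule.fg_iff_exists_fin_generating_family.1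
      (Module.Finite.fg_top (R := K) (M := L))
    refine ⟨Submodule.fg_iff_exists_fin_generating_family.2 ⟨r, s, top_le_iff.1 fun x _ => ?_⟩⟩
    obtain ⟨c, hc⟩ := (Submodule.mem_span_range_iff_exists_fun K).1
      (hs ▸ Submodule.mem_top : x ∈ Submodule.span K (Set.range s))
    exact (Submodule.mem_span_range_iff_exists_fun Kᵐᵒᵖ).2 ⟨fun a => MulOpposite.op (c a), hc⟩
  let e : P →ₗ[Kᵐᵒᵖ] (T → L) :=
    { toFun := fun x φ => (φ.1 : L ≃ₐ[k] L).symm (x.1.coeff φ.1)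
      map_add' := fun x y => by ext; simp
      map_smul' := fun a x => by
        ext φ
        change (φ.1 : L ≃ₐ[k] L).symm ((x.1 * coeffEmb K M a.unop).coeff φ.1) =
          a.unop • (φ.1 : L ≃ₐ[k] L).symm (x.1.coeff φ.1)
        rw [coeff_mul_coeffEmb, map_mul, AlgEquiv.symm_apply_apply, mul_comm, Algebra.smul_def] }
  refine Module.Finite.iff_fg.1 (Module.Finite.of_injective e fun x y h => ?_)
  ext φ
  by_cases hφ : φ ∈ T
  · exact (φ : L ≃ₐ[k] L).symm.injective (congr_fun h ⟨φ, hφ⟩)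
  · rw [x.2.2 φ hφ, y.2.2 φ hφ]

end Skew

/-- The submodule `V` of the `A`-module `X` is finitely generated over `R`, acting through
`f : R → A`. -/
def IsFGAlong {R A X : Type*} [CommRing R] [CommRing A] [AddCommGroup X] [Module A X]
    (f : R →+* A) (V : Submodule A X) : Prop :=
  ∃ (r : ℕ) (s : Fin r → X), (∀ a, s a ∈ V) ∧ ∀ x ∈ V, ∃ c : Fin r → R, x = ∑ a, f (c a) • s a

section Bimodule

variable {k Γ U : Type*} [Field k] [CommRing Γ] [Algebra k Γ] [Ring U] [Algebra k U]
  (i : Γ →ₐ[k] U)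

/-- `γ ↦ γ ⊗ 1`. -/
abbrev inclLeft (k : Type*) {Γ : Type*} [Field k] [CommRing Γ] [Algebra k Γ] : Γ →+* Γ ⊗[k] Γ :=
  ((Algebra.TensorProduct.includeLeft : Γ →ₐ[k] Γ ⊗[k] Γ) : Γ →+* Γ ⊗[k] Γ)

/-- `γ ↦ 1 ⊗ γ`. -/
abbrev inclRight (k : Type*) {Γ : Type*} [Field k] [CommRing Γ] [Algebra k Γ] : Γ →+* Γ ⊗[k] Γ :=
  ((Algebra.TensorProduct.includeRight : Γ →ₐ[k] Γ ⊗[k] Γ) : Γ →+* Γ ⊗[k] Γ)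

variable {i}

theorem Bimod.toRing_inclLeft_smul (γ : Γ) (u : Bimod i) :
    Bimod.toRing i (inclLeft k γ • u) = i γ * Bimod.toRing i u := by
  have := Bimod.toRing_tmul_smul γ 1 u
  rwa [map_one, mul_one] at this

theorem Bimod.toRing_inclRight_smul (γ : Γ) (u : Bimod i) :
    Bimod.toRing i (inclRight k γ • u) = Bimod.toRing i u * i γ := by
  have := Bimod.toRing_tmul_smul 1 γ u
  rwa [map_one, one_mul] at this

end Bimodule

section Support

variable {k L : Type*} [Field k] [Field L] [Algebra k L]
  {K : Type*} [Field K] [Algebra K L] [Algebra k K] [IsScalarTower k K L]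
  {Γ : Type*} [CommRing Γ] [Algebra k Γ] [Algebra Γ L] [IsScalarTower k Γ L]
  {M : Submonoid (L ≃ₐ[k] L)} {U : Subalgebra k (SkewMonoidAlgebra L M)}

theorem mem_supportSub (hU : IsGaloisRing K Γ M U) {S : Set M} {u : Bimod hU.incl} :
    u ∈ supportSub hU S ↔
      ∀ φ ∉ S, (Bimod.toRing hU.incl u : SkewMonoidAlgebra L M).coeff φ = 0 :=
  forall_congr' fun _ => not_imp_comm

theorem mem_invariantsOn_inf (hU : IsGaloisRing K Γ M U) {S : Set M} {u : Bimod hU.incl} :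
    (Bimod.toRing hU.incl u : SkewMonoidAlgebra L M) ∈
      invariantsOn K M S ⊓ (Subalgebra.toSubmodule U).toAddSubgroup ↔ u ∈ supportSub hU S := by
  rw [mem_supportSub]
  exact ⟨fun h => h.1.2, fun h => ⟨⟨hU.le_invariants (Bimod.toRing hU.incl u).2, h⟩,
    (Bimod.toRing hU.incl u).2⟩⟩

/-- This is the order condition applied to the finite-dimensional space of invariants supported in
`T`. -/
theorem isFGAlong_inclLeft_supportSub [FiniteDimensional K L] (hU : IsGaloisOrder K Γ M U) {T : Set M}
    (hT : T.Finite) : IsFGAlong (inclLeft k) (supportSub hU.toIsGaloisRing T) := by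
  obtain ⟨r, s, hs, h⟩ := (hU.left_order (invariantsOn K M T) (fun x hx => hx.1)
    (isLeftFG_invariantsOn hT)).exists_fin
  let t : Fin r → Bimod hU.incl := fun a => (Bimod.toRing hU.incl).symm ⟨s a, (hs a).2⟩
  refine ⟨r, t, fun a => (mem_invariantsOn_inf hU.toIsGaloisRing).1 (hs a), fun x hx => ?_⟩
  obtain ⟨c, hc⟩ := h _ ((mem_invariantsOn_inf hU.toIsGaloisRing).2 hx)
  refine ⟨c, (Bimod.toRing hU.incl).injective (Subtype.ext ?_)⟩
  rw [hc, map_sum, AddSubmonoidClass.coe_finsetSum]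
  refine Finset.sum_congr rfl fun a _ => ?_
  rw [Bimod.toRing_inclLeft_smul]
  rfl

theorem isFGAlong_inclRight_supportSub [FiniteDimensional K L] (hU : IsGaloisOrder K Γ M U) {T : Set M}
    (hT : T.Finite) : IsFGAlong (inclRight k) (supportSub hU.toIsGaloisRing T) := by
  obtain ⟨r, s, hs, h⟩ := (hU.right_order (invariantsOn K M T) (fun x hx => hx.1)
    (isRightFG_invariantsOn hT)).exists_fin
  let t : Fin r → Bimod hU.incl := fun a => (Bimod.toRing hU.incl).symm ⟨s a, (hs a).2⟩
  refine ⟨r, t, fun a => (mem_invariantsOn_inf hU.toIsGaloisRing).1 (hs a), fun x hx => ?_⟩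
  obtain ⟨c, hc⟩ := h _ ((mem_invariantsOn_inf hU.toIsGaloisRing).2 hx)
  refine ⟨c, (Bimod.toRing hU.incl).injective (Subtype.ext ?_)⟩
  rw [hc, map_sum, AddSubmonoidClass.coe_finsetSum]
  refine Finset.sum_congr rfl fun a _ => ?_
  rw [Bimod.toRing_inclRight_smul]
  rfl

/-- Every finitely generated subbimodule has finite support. -/
theorem exists_finite_le_supportSub (hU : IsGaloisRing K Γ M U)
    {V : Submodule (Γ ⊗[k] Γ) (Bimod hU.incl)} (hV : V.FG) :
    ∃ T : Set M, T.Finite ∧ V ≤ supportSub hU T := by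
  obtain ⟨F, rfl⟩ := hV
  refine ⟨⋃ u ∈ F, {φ | (Bimod.toRing hU.incl u : SkewMonoidAlgebra L M).coeff φ ≠ 0},
    Set.Finite.biUnion F.finite_toSet fun u _ => Finsupp.hasFiniteSupport _,
    Submodule.span_le.2 fun u hu φ hφ => Set.mem_biUnion hu hφ⟩

end Support

/-! ### Elements of the monoid preserve integrality -/

section Integral

variable {k L : Type*} [Field k] [Field L] [Algebra k L]
  {K : Type*} [Field K] [Algebra K L] [Algebra k K] [IsScalarTower k K L]
  {Γ : Type*} [CommRing Γ] [Algebra k Γ] [Algebra Γ L] [IsScalarTower k Γ L]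
  {M : Submonoid (L ≃ₐ[k] L)} {U : Subalgebra k (SkewMonoidAlgebra L M)}

/-- Every `φ ∈ M` is in the support of some invariant. -/
theorem exists_mem_invariants_coeff_ne_zero [FiniteDimensional K L] (hconj : ConjClosed K M)
    (φ : M) : ∃ x ∈ invariants K M, x.coeff φ ≠ 0 := by
  classical
  -- The witness is the sum, with coefficients `1`, over the conjugation orbit of `φ`.
  let o : (L ≃ₐ[K] L) → M := fun g => ⟨_, hconj g φ φ.2⟩
  have ho : (Set.range o).Finite := Set.finite_range o
  let x : SkewMonoidAlgebra L M := ∑ ψ ∈ ho.toFinset, SkewMonoidAlgebra.single ψ 1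
  have hx (ψ : M) : x.coeff ψ = if ψ ∈ Set.range o then 1 else 0 := by
    rw [← coeffHom_apply, map_sum]
    simp [coeffHom_apply, Finsupp.single_apply]
  refine ⟨x, fun g χ ψ h => ?_, ?_⟩
  · have hiff : ψ ∈ Set.range o ↔ χ ∈ Set.range o := by
      constructor
      · rintro ⟨g', rfl⟩
        refine ⟨g⁻¹ * g', Subtype.ext ?_⟩
        change (g⁻¹ * g').restrictScalars k * (φ : L ≃ₐ[k] L) * ((g⁻¹ * g').restrictScalars k)⁻¹ = χ
        have h' : g'.restrictScalars k * (φ : L ≃ₐ[k] L) * (g'.restrictScalars k)⁻¹ =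
          g.restrictScalars k * χ * (g.restrictScalars k)⁻¹ := h
        have e1 : (g⁻¹ * g').restrictScalars k = (g.restrictScalars k)⁻¹ * g'.restrictScalars k := rfl
        rw [e1, mul_inv_rev, inv_inv]
        calc _ = (g.restrictScalars k)⁻¹ * (g'.restrictScalars k * (φ : L ≃ₐ[k] L) *
                  (g'.restrictScalars k)⁻¹) * g.restrictScalars k := by group
          _ = _ := by rw [h']; group
      · rintro ⟨g', rfl⟩
        refine ⟨g * g', Subtype.ext ?_⟩
        change (g * g').restrictScalars k * (φ : L ≃ₐ[k] L) * ((g * g').restrictScalars k)⁻¹ = ψ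
        have e1 : (g * g').restrictScalars k = g.restrictScalars k * g'.restrictScalars k := rfl
        rw [h, e1, mul_inv_rev]
        change _ = g.restrictScalars k * (g'.restrictScalars k * (φ : L ≃ₐ[k] L) *
          (g'.restrictScalars k)⁻¹) * _
        group
    rw [hx, hx]
    simp only [hiff]
    split_ifs <;> simp
  · have : φ ∈ Set.range o := ⟨1, Subtype.ext (by
      change (1 : L ≃ₐ[k] L) * φ * (1 : L ≃ₐ[k] L)⁻¹ = φ
      group)⟩
    rw [hx, if_pos this]
    exact one_ne_zero

/-- Every `φ ∈ M` is in the support of some element of a Galois ring. -/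
theorem IsGaloisRing.exists_coeff_ne_zero [FiniteDimensional K L] (hU : IsGaloisRing K Γ M U)
    (hconj : ConjClosed K M) (φ : M) : ∃ u ∈ U, u.coeff φ ≠ 0 := by
  by_contra! h
  obtain ⟨x, hx, hφ⟩ := exists_mem_invariants_coeff_ne_zero (K := K) hconj φ
  rw [← hU.left_span] at hx
  refine hφ ?_
  clear hφ
  induction hx using Submodule.mul_induction_on' with
  | mem_mul_mem a ha u hu =>
    obtain ⟨a, rfl⟩ := ha
    exact (coeff_coeffEmb_mul a u φ).trans (by rw [h u hu, mul_zero])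
  | add x _ y _ hx hy => simp [hx, hy]

theorem isIntegral_apply_of_forall (f : L →+* L)
    (hf : ∀ δ : Γ, IsIntegral Γ (f (algebraMap Γ L δ))) {x : L} (hx : IsIntegral Γ x) :
    IsIntegral Γ (f x) := by
  let g : Γ →+* integralClosure Γ L := (f.comp (algebraMap Γ L)).codRestrict _ hf
  have : IsIntegral (integralClosure Γ L) (f x) := hx.map_of_comp_eq g f rfl
  exact isIntegral_trans _ this

variable [FiniteDimensional K L]

/-- The determinant trick: the coefficients at `φ` of elements of `U(T)`, with `T` finite, span a
finitely generated nonzero `Γ`-submodule of `L`, and right multiplication by `δ` makes it stable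
under `φ(δ)`. -/
theorem isIntegral_apply_algebraMap (hU : IsGaloisOrder K Γ M U) (hconj : ConjClosed K M) (φ : M)
    (δ : Γ) : IsIntegral Γ ((φ : L ≃ₐ[k] L) (algebraMap Γ L δ)) := by
  obtain ⟨u, hu, hφ⟩ := hU.toIsGaloisRing.exists_coeff_ne_zero hconj φ
  let u' : Bimod hU.incl := (Bimod.toRing hU.incl).symm ⟨u, hu⟩
  obtain ⟨T, hT, hV⟩ := exists_finite_le_supportSub hU.toIsGaloisRing
    (Submodule.fg_span (Set.finite_singleton u'))
  obtain ⟨r, s, hs, h⟩ := isFGAlong_inclLeft_supportSub hU hT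
  let C : Bimod hU.incl → L := fun v => (Bimod.toRing hU.incl v : SkewMonoidAlgebra L M).coeff φ
  have hC (v : Bimod hU.incl) (hv : v ∈ supportSub hU.toIsGaloisRing T) :
      C v ∈ Submodule.span Γ (Set.range (C ∘ s)) := by
    obtain ⟨c, rfl⟩ := h v hv
    have : C (∑ a, inclLeft k (c a) • s a) = ∑ a, c a • C (s a) := by
      change coeffHom φ (U.val (Bimod.toRing hU.incl (∑ a, inclLeft k (c a) • s a))) = _
      simp only [map_sum]
      refine Finset.sum_congr rfl fun a _ => ?_
      rw [Bimod.toRing_inclLeft_smul, map_mul]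
      exact (coeff_coeffEmb_mul _ _ φ).trans (Algebra.smul_def _ _).symm
    rw [this]
    exact sum_mem fun a _ => Submodule.smul_mem _ _ (Submodule.subset_span ⟨a, rfl⟩)
  refine isIntegral_of_smul_mem_submodule (M := L) (Submodule.span Γ (Set.range (C ∘ s)))
    (fun h0 => ?_) (Submodule.fg_span (Set.finite_range _)) _ fun x hx => ?_
  · have := hC u' (hV (Submodule.mem_span_singleton_self u'))
    rw [h0] at this
    exact hφ this
  · induction hx using Submodule.span_induction with
    | mem x hx =>
      obtain ⟨a, rfl⟩ := hx
      have : (φ : L ≃ₐ[k] L) (algebraMap Γ L δ) • (C ∘ s) a = C (inclRight k δ • s a) := by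
        change _ = (Bimod.toRing hU.incl (inclRight k δ • s a) : SkewMonoidAlgebra L M).coeff φ
        rw [Bimod.toRing_inclRight_smul]
        exact (mul_comm _ _).trans (coeff_mul_coeffEmb δ _ φ).symm
      rw [this]
      exact hC _ (Submodule.smul_mem _ _ (hs a))
    | zero => rw [smul_zero]; exact zero_mem _
    | add x y _ _ hx hy => rw [smul_add]; exact add_mem hx hy
    | smul a x _ hx => rw [smul_comm]; exact Submodule.smul_mem _ _ hx

/-- The mirror image: after applying `φ⁻¹` to the coefficients, the right action becomes `Γ`-linear
and left multiplication by `δ` becomes multiplication by `φ⁻¹(δ)`. -/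
theorem isIntegral_symm_apply_algebraMap (hU : IsGaloisOrder K Γ M U) (hconj : ConjClosed K M)
    (φ : M) (δ : Γ) : IsIntegral Γ ((φ : L ≃ₐ[k] L).symm (algebraMap Γ L δ)) := by
  obtain ⟨u, hu, hφ⟩ := hU.toIsGaloisRing.exists_coeff_ne_zero hconj φ
  let u' : Bimod hU.incl := (Bimod.toRing hU.incl).symm ⟨u, hu⟩
  obtain ⟨T, hT, hV⟩ := exists_finite_le_supportSub hU.toIsGaloisRing
    (Submodule.fg_span (Set.finite_singleton u'))
  obtain ⟨r, s, hs, h⟩ := isFGAlong_inclRight_supportSub hU hT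
  let C : Bimod hU.incl → L := fun v =>
    (φ : L ≃ₐ[k] L).symm ((Bimod.toRing hU.incl v : SkewMonoidAlgebra L M).coeff φ)
  have hC (v : Bimod hU.incl) (hv : v ∈ supportSub hU.toIsGaloisRing T) :
      C v ∈ Submodule.span Γ (Set.range (C ∘ s)) := by
    obtain ⟨c, rfl⟩ := h v hv
    have : C (∑ a, inclRight k (c a) • s a) = ∑ a, c a • C (s a) := by
      change (φ : L ≃ₐ[k] L).symm
        (coeffHom φ (U.val (Bimod.toRing hU.incl (∑ a, inclRight k (c a) • s a)))) = _
      simp only [map_sum]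
      refine Finset.sum_congr rfl fun a _ => ?_
      rw [Bimod.toRing_inclRight_smul, map_mul, Algebra.smul_def, mul_comm]
      refine (congrArg _ (coeff_mul_coeffEmb (c a) _ φ)).trans ?_
      rw [map_mul, AlgEquiv.symm_apply_apply]
      rfl
    rw [this]
    exact sum_mem fun a _ => Submodule.smul_mem _ _ (Submodule.subset_span ⟨a, rfl⟩)
  refine isIntegral_of_smul_mem_submodule (M := L) (Submodule.span Γ (Set.range (C ∘ s)))
    (fun h0 => ?_) (Submodule.fg_span (Set.finite_range _)) _ fun x hx => ?_
  · have := hC u' (hV (Submodule.mem_span_singleton_self u'))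
    rw [h0] at this
    exact hφ (((φ : L ≃ₐ[k] L).symm.map_eq_zero_iff).1 this)
  · induction hx using Submodule.span_induction with
    | mem x hx =>
      obtain ⟨a, rfl⟩ := hx
      have : (φ : L ≃ₐ[k] L).symm (algebraMap Γ L δ) • (C ∘ s) a = C (inclLeft k δ • s a) := by
        change _ = (φ : L ≃ₐ[k] L).symm
          ((Bimod.toRing hU.incl (inclLeft k δ • s a) : SkewMonoidAlgebra L M).coeff φ)
        rw [Bimod.toRing_inclLeft_smul]
        refine Eq.trans ?_ (congrArg _ (coeff_coeffEmb_mul δ _ φ).symm)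
        rw [map_mul]
        rfl
      rw [this]
      exact hC _ (Submodule.smul_mem _ _ (hs a))
    | zero => rw [smul_zero]; exact zero_mem _
    | add x y _ _ hx hy => rw [smul_add]; exact add_mem hx hy
    | smul a x _ hx => rw [smul_comm]; exact Submodule.smul_mem _ _ hx

theorem isIntegral_apply (hU : IsGaloisOrder K Γ M U) (hconj : ConjClosed K M) (φ : M) {x : L}
    (hx : IsIntegral Γ x) : IsIntegral Γ ((φ : L ≃ₐ[k] L) x) :=
  isIntegral_apply_of_forall ((φ : L ≃ₐ[k] L) : L →+* L)
    (isIntegral_apply_algebraMap hU hconj φ) hx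

theorem isIntegral_symm_apply (hU : IsGaloisOrder K Γ M U) (hconj : ConjClosed K M) (φ : M) {x : L}
    (hx : IsIntegral Γ x) : IsIntegral Γ ((φ : L ≃ₐ[k] L).symm x) :=
  isIntegral_apply_of_forall ((φ : L ≃ₐ[k] L).symm : L →+* L)
    (isIntegral_symm_apply_algebraMap hU hconj φ) hx

end Integral

/-! ### Removing the support outside `S(m, n)` -/

section Link

open scoped Pointwise

variable {k L : Type*} [Field k] [Field L] [Algebra k L]
  {Γ : Type*} [CommRing Γ] [Algebra k Γ] [Algebra Γ L] [IsScalarTower k Γ L]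

/-- The action of `Γ ⊗ Γ` on the coefficient at `φ`: `γ ⊗ δ ↦ γ φ(δ)`. -/
def twistHom (Γ : Type*) [CommRing Γ] [Algebra k Γ] [Algebra Γ L] [IsScalarTower k Γ L]
    (φ : L ≃ₐ[k] L) : Γ ⊗[k] Γ →ₐ[k] L :=
  Algebra.TensorProduct.lift (IsScalarTower.toAlgHom k Γ L)
    ((φ : L →ₐ[k] L).comp (IsScalarTower.toAlgHom k Γ L)) (fun _ _ => mul_comm _ _)

theorem twistHom_tmul (φ : L ≃ₐ[k] L) (γ δ : Γ) :
    twistHom Γ φ (γ ⊗ₜ δ) = algebraMap Γ L γ * φ (algebraMap Γ L δ) :=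
  Algebra.TensorProduct.lift_tmul _ _ _ _ _

variable {K : Type*} [Field K] [Algebra K L] [Algebra k K] [IsScalarTower k K L]
  {M : Submonoid (L ≃ₐ[k] L)} {U : Subalgebra k (SkewMonoidAlgebra L M)}

/-- This turns the removal of `φ` from the support into membership in the kernel of `twistHom`. -/
theorem coeff_smul_bimod (hU : IsGaloisRing K Γ M U) (a : Γ ⊗[k] Γ) (u : Bimod hU.incl) (φ : M) :
    (Bimod.toRing hU.incl (a • u) : SkewMonoidAlgebra L M).coeff φ =
      twistHom Γ (φ : L ≃ₐ[k] L) a * (Bimod.toRing hU.incl u : SkewMonoidAlgebra L M).coeff φ := by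
  induction a using TensorProduct.induction_on with
  | zero => simp
  | add a b ha hb => simp [add_smul, add_mul, ha, hb]
  | tmul γ δ =>
    rw [Bimod.toRing_tmul_smul, twistHom_tmul, mul_right_comm]
    refine (coeff_mul_coeffEmb δ _ φ).trans ?_
    rw [← coeff_coeffEmb_mul]
    rfl

theorem map_le_of_biIdeal_le {m n : MaximalSpectrum Γ} {p : Ideal (Γ ⊗[k] Γ)}
    (h : biIdeal k m n ≤ p) :
    n.asIdeal ≤ p.comap (inclLeft k) ∧ m.asIdeal ≤ p.comap (inclRight k) :=
  ⟨Ideal.map_le_iff_le_comap.1 (le_sup_left.trans h),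
    Ideal.map_le_iff_le_comap.1 (le_sup_right.trans h)⟩

theorem smulCommClass_of_tower [Algebra Γ K] [IsScalarTower Γ K L] :
    SMulCommClass (L ≃ₐ[K] L) Γ L where
  smul_comm g γ x := by
    rw [← algebraMap_smul K γ x, ← algebraMap_smul K γ (g • x)]
    exact map_smul g _ _

theorem idealSet_smul [SMulCommClass (L ≃ₐ[K] L) Γ L]
    (ℓ : MaximalSpectrum (integralClosure Γ L)) (g : L ≃ₐ[K] L) :
    (fun x : integralClosure Γ L => (x : L)) '' ((g • ℓ.asIdeal : Ideal _) : Set _) =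
      g '' idealSet ℓ := by
  rw [idealSet, Set.image_image]
  ext y
  constructor
  · rintro ⟨x, hx, rfl⟩
    refine ⟨g⁻¹ • x, Ideal.mem_pointwise_smul_iff_inv_smul_mem.1 hx, ?_⟩
    change g • ((g⁻¹ • x : integralClosure Γ L) : L) = x
    rw [integralClosure.coe_smul, smul_inv_smul]
  · rintro ⟨x, hx, rfl⟩
    exact ⟨g • x, Ideal.smul_mem_pointwise_smul g x _ hx, rfl⟩

variable [FiniteDimensional K L] [IsGalois K L] [Algebra Γ K] [IsScalarTower Γ K L]
  [IsFractionRing Γ K] [IsIntegrallyClosed Γ]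

/-- The Galois group acts transitively on the maximal ideals over a given one. -/
theorem exists_eq_image_idealSet {m : MaximalSpectrum Γ}
    {ℓ : MaximalSpectrum (integralClosure Γ L)}
    (hm : ℓ.asIdeal.comap (algebraMap Γ (integralClosure Γ L)) = m.asIdeal)
    (q : Ideal (integralClosure Γ L)) [q.IsPrime]
    (hq : m.asIdeal ≤ q.comap (algebraMap Γ (integralClosure Γ L))) :
    ∃ g : L ≃ₐ[K] L, (fun x : integralClosure Γ L => (x : L)) '' (q : Set _) = g '' idealSet ℓ := by
  have hq' : m.asIdeal = q.comap (algebraMap Γ (integralClosure Γ L)) :=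
    m.isMaximal.eq_of_le (Ideal.IsPrime.comap (hK := ‹q.IsPrime›) _).ne_top hq
  have : SMulCommClass (L ≃ₐ[K] L) Γ L := smulCommClass_of_tower
  -- A Galois-invariant integral element lies in `K`, hence in `Γ` because `Γ` is normal.
  have hinv : Algebra.IsInvariant Γ (integralClosure Γ L) (L ≃ₐ[K] L) := by
    refine ⟨fun b hb => ?_⟩
    have h1 : (b : L) ∈ Set.range (algebraMap K L) := by
      rw [IsGalois.mem_range_algebraMap_iff_fixed]
      exact fun g => congrArg Subtype.val (hb g)
    obtain ⟨a, ha⟩ := h1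
    have h2 : IsIntegral Γ a := (isIntegral_algHom_iff (IsScalarTower.toAlgHom Γ K L)
      (algebraMap K L).injective).1 (by
        change IsIntegral Γ (algebraMap K L a)
        rw [ha]
        exact b.2)
    obtain ⟨γ, rfl⟩ := IsIntegrallyClosed.algebraMap_eq_of_integral h2
    refine ⟨γ, Subtype.ext ?_⟩
    rw [← ha, ← IsScalarTower.algebraMap_apply]
    rfl
  have := ℓ.isMaximal.isPrime
  obtain ⟨g, hg⟩ := Algebra.IsInvariant.exists_smul_of_under_eq Γ (integralClosure Γ L) (L ≃ₐ[K] L)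
    ℓ.asIdeal q (hm.trans hq')
  exact ⟨g, by rw [hg, idealSet_smul]⟩

variable {m n : MaximalSpectrum Γ} {ℓm ℓn : MaximalSpectrum (integralClosure Γ L)}

/-- For `φ ∉ S(m, n)`, the kernel of the action on the coefficient at `φ` is comaximal with
`n ⊗ Γ + Γ ⊗ m`. -/
theorem ker_twistHom_sup_biIdeal (hU : IsGaloisOrder K Γ M U) (hconj : ConjClosed K M)
    (hm : ℓm.asIdeal.comap (algebraMap Γ (integralClosure Γ L)) = m.asIdeal)
    (hn : ℓn.asIdeal.comap (algebraMap Γ (integralClosure Γ L)) = n.asIdeal)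
    {φ : M} (hφ : φ ∉ linkSet K M ℓm ℓn) :
    RingHom.ker (twistHom Γ (φ : L ≃ₐ[k] L)) ⊔ biIdeal k m n = ⊤ := by
  by_contra htop
  obtain ⟨p, hp, hle⟩ := Ideal.exists_le_maximal _ htop
  refine hφ ?_
  have hint (a : Γ ⊗[k] Γ) : IsIntegral Γ (twistHom Γ (φ : L ≃ₐ[k] L) a) := by
    induction a using TensorProduct.induction_on with
    | zero => rw [map_zero]; exact isIntegral_zero
    | add a b ha hb => rw [map_add]; exact ha.add hb
    | tmul γ δ =>
      rw [twistHom_tmul]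
      exact isIntegral_algebraMap.mul (isIntegral_apply_algebraMap hU hconj φ δ)
  let θ : Γ ⊗[k] Γ →+* integralClosure Γ L :=
    (twistHom Γ (φ : L ≃ₐ[k] L) : Γ ⊗[k] Γ →+* L).codRestrict _ hint
  have hθ : θ.comp (inclLeft k) = algebraMap Γ (integralClosure Γ L) := by
    ext γ
    exact (twistHom_tmul _ γ 1).trans (by rw [map_one, map_one, mul_one]; rfl)
  let := θ.toAlgebra
  -- Integrality already holds over `Γ ⊗ 1`, so a maximal ideal `q` lies over `p`. Then `q` lies
  -- over `n`, and `φ⁻¹ q` over `m`.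
  have : Algebra.IsIntegral (Γ ⊗[k] Γ) (integralClosure Γ L) := ⟨by
    refine RingHom.IsIntegral.tower_top (inclLeft k) θ ?_
    rw [hθ]
    exact Algebra.IsIntegral.isIntegral⟩
  have hker : RingHom.ker θ ≤ p := fun a ha =>
    hle (Ideal.mem_sup_left (congrArg Subtype.val (show θ a = 0 from ha)))
  obtain ⟨q, hq, hqp⟩ := Ideal.exists_ideal_over_maximal_of_isIntegral (S := integralClosure Γ L) p hker
  obtain ⟨hpn, hpm⟩ := map_le_of_biIdeal_le (le_sup_right.trans hle)
  have hqp' : q.comap θ = p := hqp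
  rw [← hqp', Ideal.comap_comap] at hpn hpm
  rw [hθ] at hpn
  let φ' : integralClosure Γ L →+* integralClosure Γ L :=
    (((φ : L ≃ₐ[k] L) : L →+* L).comp (algebraMap (integralClosure Γ L) L)).codRestrict _
      fun x => isIntegral_apply hU hconj φ x.2
  have hφ' : θ.comp (inclRight k) = φ'.comp (algebraMap Γ (integralClosure Γ L)) := by
    ext δ
    exact (twistHom_tmul _ 1 δ).trans (by rw [map_one, one_mul]; rfl)
  rw [hφ', ← Ideal.comap_comap] at hpm
  have := hq.isPrime
  have : (q.comap φ').IsPrime := Ideal.IsPrime.comap φ'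
  obtain ⟨g₂, h₂⟩ := exists_eq_image_idealSet (K := K) hn q hpn
  obtain ⟨g₁, h₁⟩ := exists_eq_image_idealSet (K := K) hm (q.comap φ') hpm
  refine ⟨g₁, g₂, ?_⟩
  rw [← h₁, ← h₂, Set.image_image]
  ext y
  constructor
  · rintro ⟨x, hx, rfl⟩
    exact ⟨φ' x, hx, rfl⟩
  · rintro ⟨x, hx, rfl⟩
    let z : integralClosure Γ L :=
      ⟨(φ : L ≃ₐ[k] L).symm x, isIntegral_symm_apply hU hconj φ x.2⟩
    have hz : φ' z = x := Subtype.ext (AlgEquiv.apply_symm_apply (φ : L ≃ₐ[k] L) x)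
    exact ⟨z, show φ' z ∈ q from hz ▸ hx, AlgEquiv.apply_symm_apply _ _⟩

/-- A finitely generated subbimodule is moved into `U(S)`, `S = S(m, n)`, by some element of
`1 + n ⊗ Γ + Γ ⊗ m`. -/
theorem exists_smul_mem_supportSub (hU : IsGaloisOrder K Γ M U) (hconj : ConjClosed K M)
    (hm : ℓm.asIdeal.comap (algebraMap Γ (integralClosure Γ L)) = m.asIdeal)
    (hn : ℓn.asIdeal.comap (algebraMap Γ (integralClosure Γ L)) = n.asIdeal)
    {V : Submodule (Γ ⊗[k] Γ) (Bimod hU.incl)} (hV : V.FG) :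
    ∃ f : Γ ⊗[k] Γ, 1 - f ∈ biIdeal k m n ∧
      ∀ v ∈ V, f • v ∈ supportSub hU.toIsGaloisRing (linkSet K M ℓm ℓn) := by
  obtain ⟨T, hT, hle⟩ := exists_finite_le_supportSub hU.toIsGaloisRing hV
  have key : ∃ f : Γ ⊗[k] Γ, 1 - f ∈ biIdeal k m n ∧
      ∀ φ ∈ T, φ ∉ linkSet K M ℓm ℓn → twistHom Γ (φ : L ≃ₐ[k] L) f = 0 := by
    clear hle
    induction T, hT using Set.Finite.induction_on with
    | empty => exact ⟨1, by simp, by simp⟩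
    | @insert φ T _ _ ih =>
      obtain ⟨f, hf, hfT⟩ := ih
      by_cases hφ : φ ∈ linkSet K M ℓm ℓn
      · refine ⟨f, hf, ?_⟩
        rintro ψ (rfl | hψ) h
        exacts [absurd hφ h, hfT ψ hψ h]
      · have htop := ker_twistHom_sup_biIdeal hU hconj hm hn hφ
        obtain ⟨a, ha, b, hb, hab⟩ := Submodule.mem_sup.1 ((Ideal.eq_top_iff_one _).1 htop)
        have ha' : twistHom Γ (φ : L ≃ₐ[k] L) a = 0 := ha
        refine ⟨a * f, ?_, ?_⟩
        · have : 1 - a * f = b * f + (1 - f) := by rw [← sub_eq_iff_eq_add'.2 hab.symm]; ring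
          rw [this]
          exact add_mem (Ideal.mul_mem_right _ _ hb) hf
        · rintro ψ (rfl | hψ) h
          · rw [map_mul, ha', zero_mul]
          · rw [map_mul, hfT ψ hψ h, mul_zero]
  obtain ⟨f, hf, hfT⟩ := key
  refine ⟨f, hf, fun v hv => (mem_supportSub hU.toIsGaloisRing).2 fun φ hφ => ?_⟩
  rw [coeff_smul_bimod]
  by_cases hφT : φ ∈ T
  · rw [hfT φ hφT hφ, zero_mul]
  · rw [(mem_supportSub hU.toIsGaloisRing).1 (hle hv) φ hφT, mul_zero]

end Link

/-! ### Bimodules finitely generated on both sides -/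

section Along

variable {R A X : Type*} [CommRing R] [CommRing A] [AddCommGroup X] [Module A X]

theorem IsFGAlong.fg {f : R →+* A} {V : Submodule A X} (h : IsFGAlong f V) : V.FG := by
  obtain ⟨r, s, hs, h⟩ := h
  refine Submodule.fg_iff_exists_fin_generating_family.2 ⟨r, s, le_antisymm ?_ fun x hx => ?_⟩
  · exact Submodule.span_le.2 (Set.range_subset_iff.2 hs)
  · obtain ⟨c, rfl⟩ := h x hx
    exact sum_mem fun a _ => Submodule.smul_mem _ _ (Submodule.subset_span ⟨a, rfl⟩)

/-- Through `g`, `X` is a finitely generated `R`-module killed by `m`, so it is Artinian over `R`;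
the `A`-submodules are among the `R`-submodules. -/
theorem isArtinian_of_isFGAlong [IsNoetherianRing R] (m : Ideal R) [m.IsMaximal] (g : R →+* A)
    (hX : IsFGAlong g (⊤ : Submodule A X)) (hm : ∀ μ ∈ m, ∀ x : X, g μ • x = 0) :
    IsArtinian A X := by
  let := g.toAlgebra
  let := Module.compHom X g
  have : IsScalarTower R A X := ⟨fun r a x => by
    rw [Algebra.smul_def, mul_smul]; rfl⟩
  obtain ⟨r, s, -, hs⟩ := hX
  have : Module.Finite R X := ⟨Submodule.fg_iff_exists_fin_generating_family.2
    ⟨r, s, top_le_iff.1 fun x hx => by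
      obtain ⟨c, hc⟩ := hs x hx
      exact (Submodule.mem_span_range_iff_exists_fun R).2 ⟨c, hc.symm⟩⟩⟩
  have : IsArtinian R X :=
    isArtinian_of_pow_smul_eq_zero m 1 fun γ hγ x => hm γ (by rwa [pow_one] at hγ) x
  exact isArtinian_of_tower R this

/-- If `X` is finitely generated on both sides and `m` kills it on one side, then the
`m`-component of `X` on the other side is cut out by an element of `1 + m`. -/
theorem exists_sub_one_mem_pow_smul_eq_zero [IsNoetherianRing R] (m : Ideal R) [m.IsMaximal]
    (f g : R →+* A) (hf : IsFGAlong f (⊤ : Submodule A X)) (hg : IsFGAlong g (⊤ : Submodule A X))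
    (hm : ∀ μ ∈ m, ∀ x : X, g μ • x = 0) :
    ∃ e : R, e - 1 ∈ m ∧ ∃ c, ∀ γ ∈ m ^ c, ∀ x : X, f (γ * e) • x = 0 := by
  have := isArtinian_of_isFGAlong m g hg hm
  let := f.toAlgebra
  let := Module.compHom X f
  have : IsScalarTower R A X := ⟨fun r a x => by
    rw [Algebra.smul_def, mul_smul]; rfl⟩
  obtain ⟨r, s, -, hs⟩ := hf
  have : Module.Finite R X := ⟨Submodule.fg_iff_exists_fin_generating_family.2
    ⟨r, s, top_le_iff.1 fun x hx => by
      obtain ⟨c, hc⟩ := hs x hx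
      exact (Submodule.mem_span_range_iff_exists_fun R).2 ⟨c, hc.symm⟩⟩⟩
  -- The `f`-side chain `m ^ c X` consists of `A`-submodules, so it stops by the Artinian property
  -- coming from the `g`-side; Nakayama on the `f`-side then yields `e`.
  obtain ⟨c, hc⟩ := IsArtinian.monotone_stabilizes
    (⟨fun c => OrderDual.toDual ((m.map (algebraMap R A)) ^ c • (⊤ : Submodule A X)),
      fun _ _ h => Submodule.smul_mono_left (Ideal.pow_le_pow_right h)⟩ : ℕ →o (Submodule A X)ᵒᵈ)
  have h1 : (m ^ c • ⊤ : Submodule R X) = m ^ (c + 1) • ⊤ := by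
    have h2 : (m.map (algebraMap R A)) ^ c • (⊤ : Submodule A X) =
      (m.map (algebraMap R A)) ^ (c + 1) • ⊤ := OrderDual.toDual.injective (hc (c + 1) (Nat.le_succ c))
    have h3 := congrArg (Submodule.restrictScalars R) h2
    rwa [← Ideal.map_pow, ← Ideal.map_pow, Ideal.smul_restrictScalars, Ideal.smul_restrictScalars,
      Submodule.restrictScalars_top] at h3
  obtain ⟨e, he, h2⟩ := Submodule.exists_sub_one_mem_and_smul_eq_zero_of_fg_of_le_smul m
    (m ^ c • ⊤ : Submodule R X) (IsNoetherian.noetherian _) (by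
      rw [← Submodule.mul_smul, ← pow_succ', ← h1])
  refine ⟨e, he, c, fun γ hγ x => ?_⟩
  rw [mul_comm]
  have := h2 (γ • x) (Submodule.smul_mem_smul hγ trivial)
  rwa [smul_smul] at this

end Along

/-! ### The module `U / U m` and simple modules with an `m`-component -/

section Weight

variable {k Γ U : Type*} [Field k] [CommRing Γ] [Algebra k Γ] [Ring U] [Algebra k U]
  (i : Γ →ₐ[k] U) (m : MaximalSpectrum Γ)

/-- The left ideal `U m`. -/
def weightIdeal : Submodule U U := Submodule.span U (i '' m.asIdeal)

variable {i m}

/-- Commutativity of `Γ` lets `δ` pass to the left of the generators, so the left ideal `U m` is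
also a subbimodule. -/
theorem mul_mem_weightIdeal {x : U} (hx : x ∈ weightIdeal i m) (δ : Γ) :
    x * i δ ∈ weightIdeal i m := by
  induction hx using Submodule.span_induction with
  | mem x hx =>
    obtain ⟨μ, hμ, rfl⟩ := hx
    rw [← map_mul, mul_comm, map_mul]
    exact Submodule.smul_mem _ (i δ) (Submodule.subset_span ⟨μ, hμ, rfl⟩)
  | zero => rw [zero_mul]; exact zero_mem _
  | add x y _ _ hx hy => rw [add_mul]; exact add_mem hx hy
  | smul a x _ hx => rw [smul_eq_mul, mul_assoc]; exact Submodule.smul_mem _ a hx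

variable (i m) in
/-- The left ideal `U m` as a subbimodule. -/
def weightSub : Submodule (Γ ⊗[k] Γ) (Bimod i) where
  carrier := {u | Bimod.toRing i u ∈ weightIdeal i m}
  add_mem' hx hy := by
    rw [Set.mem_ofPred_eq, map_add]; exact add_mem hx hy
  zero_mem' := by rw [Set.mem_ofPred_eq, map_zero]; exact zero_mem _
  smul_mem' a x hx := by
    induction a using TensorProduct.induction_on with
    | zero => rw [zero_smul, Set.mem_ofPred_eq, map_zero]; exact zero_mem _
    | add a b ha hb => rw [add_smul, Set.mem_ofPred_eq, map_add]; exact add_mem ha hb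
    | tmul γ δ =>
      rw [Set.mem_ofPred_eq, Bimod.toRing_tmul_smul]
      exact mul_mem_weightIdeal (Submodule.smul_mem _ (i γ) hx) δ

theorem mem_weightSub {u : Bimod i} :
    u ∈ weightSub i m ↔ Bimod.toRing i u ∈ weightIdeal i m := Iff.rfl

theorem inclRight_smul_mem_weightSub {μ : Γ} (hμ : μ ∈ m.asIdeal) (u : Bimod i) :
    inclRight k μ • u ∈ weightSub i m := by
  rw [mem_weightSub, Bimod.toRing_inclRight_smul]
  exact Submodule.smul_mem _ _ (Submodule.subset_span ⟨μ, hμ, rfl⟩)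

theorem IsFGAlong.quotient {R A X : Type*} [CommRing R] [CommRing A] [AddCommGroup X] [Module A X]
    {f : R →+* A} {V : Submodule A X} (h : IsFGAlong f V) (N : Submodule A V) :
    IsFGAlong f (⊤ : Submodule A (V ⧸ N)) := by
  obtain ⟨r, s, hs, h⟩ := h
  refine ⟨r, fun a => N.mkQ ⟨s a, hs a⟩, fun _ => trivial, fun x _ => ?_⟩
  obtain ⟨x, rfl⟩ := N.mkQ_surjective x
  obtain ⟨c, hc⟩ := h x x.2
  refine ⟨c, ?_⟩
  simp only [← map_smul, ← map_sum]
  congr 1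
  ext
  rw [hc]
  simp

/-- An element of a subbimodule that is finitely generated on both sides splits modulo `U m` into
its `m`-component and a complement. -/
theorem exists_split_mod_weightIdeal [IsNoetherianRing Γ] {V : Submodule (Γ ⊗[k] Γ) (Bimod i)}
    (hl : IsFGAlong (inclLeft k) V) (hr : IsFGAlong (inclRight k) V) {u : Bimod i} (hu : u ∈ V) :
    ∃ e : Γ, e - 1 ∈ m.asIdeal ∧ ∃ c, ∀ γ ∈ m.asIdeal ^ c,
      i γ * (i e * Bimod.toRing i u) ∈ weightIdeal i m := by
  have := m.isMaximal
  obtain ⟨e, he, c, h⟩ := exists_sub_one_mem_pow_smul_eq_zero m.asIdeal (inclLeft k) (inclRight k)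
    (hl.quotient ((weightSub i m).comap V.subtype)) (hr.quotient ((weightSub i m).comap V.subtype))
    fun μ hμ x => by
      obtain ⟨x, rfl⟩ := Submodule.mkQ_surjective _ x
      rw [← map_smul]
      exact (Submodule.Quotient.mk_eq_zero _).2 (inclRight_smul_mem_weightSub hμ (x : Bimod i))
  refine ⟨e, he, c, fun γ hγ => ?_⟩
  have h1 := h γ hγ (Submodule.mkQ _ ⟨u, hu⟩)
  rw [← map_smul] at h1
  have h3 : inclLeft k (γ * e) • (⟨u, hu⟩ : V) ∈ (weightSub i m).comap V.subtype :=
    (Submodule.Quotient.mk_eq_zero _).1 h1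
  have h2 : inclLeft k (γ * e) • u ∈ weightSub i m := h3
  rwa [mem_weightSub, Bimod.toRing_inclLeft_smul, map_mul, mul_assoc] at h2

/-- If some element of `1 + m ⊗ Γ + Γ ⊗ m` moves `u` into `W`, then `u` lies in `W + U m` as soon
as its class modulo `U m` is killed by a power of `m`. -/
theorem exists_sub_mem_weightSub {W : Submodule (Γ ⊗[k] Γ) (Bimod i)} {u : Bimod i}
    {f : Γ ⊗[k] Γ} (hf : 1 - f ∈ biIdeal k m m) (hW : f • u ∈ W) {c : ℕ}
    (hc : ∀ γ ∈ m.asIdeal ^ c, i γ * Bimod.toRing i u ∈ weightIdeal i m) :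
    ∃ w ∈ W, u - w ∈ weightSub i m := by
  -- The annihilator of the class of `u` contains `m ^ c ⊗ 1` and `1 ⊗ m`, hence also `(1 - f) ^ c`.
  let I : Ideal (Γ ⊗[k] Γ) := (weightSub i m).comap (LinearMap.toSpanSingleton _ _ u)
  have hl : (m.asIdeal ^ c).map (inclLeft k) ≤ I := Ideal.map_le_iff_le_comap.2 fun γ hγ => by
    change inclLeft k γ • u ∈ weightSub i m
    rw [mem_weightSub, Bimod.toRing_inclLeft_smul]
    exact hc γ hγ
  have hr : m.asIdeal.map (inclRight k) ≤ I := Ideal.map_le_iff_le_comap.2 fun γ hγ =>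
    inclRight_smul_mem_weightSub hγ u
  obtain ⟨a, ha, b, hb, hab⟩ := Submodule.mem_sup.1 hf
  have h1 : (1 - f) ^ c ∈ I := by
    have h2 : a ^ c ∈ I := hl (by rw [Ideal.map_pow]; exact Ideal.pow_mem_pow ha c)
    have h3 : (1 - f) ^ c - a ^ c ∈ I := by
      obtain ⟨d, hd⟩ := sub_dvd_pow_sub_pow (1 - f) a c
      rw [hd, ← hab, add_sub_cancel_left]
      exact I.mul_mem_right _ (hr hb)
    simpa using add_mem h3 h2
  -- Since `1 - (1 - f) ^ c = f d`, the element `d f u ∈ W` represents the class of `u`.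
  obtain ⟨d, hd⟩ := sub_dvd_pow_sub_pow 1 (1 - f) c
  rw [one_pow, sub_sub_cancel] at hd
  refine ⟨d • f • u, W.smul_mem d hW, ?_⟩
  have h4 : u - d • f • u = (1 - f) ^ c • u := by
    rw [smul_smul, mul_comm, ← hd, sub_smul, one_smul, sub_sub_cancel]
  rw [h4]
  exact h1

/-- A module with a nonzero `m`-component contains a nonzero vector killed by `m`. -/
theorem HasWeight.exists_smul_eq_zero {N : Type*} [AddCommGroup N] [Module U N]
    (h : HasWeight i m N) : ∃ v : N, v ≠ 0 ∧ ∀ γ ∈ m.asIdeal, i γ • v = 0 := by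
  obtain ⟨v, hv, r, hr⟩ := h
  induction r generalizing v with
  | zero => exact absurd (by simpa using hr 1 (by simp)) hv
  | succ r ih =>
    by_cases h : ∀ γ ∈ m.asIdeal ^ r, i γ • v = 0
    · exact ih v hv h
    · push Not at h
      obtain ⟨γ, hγ, h⟩ := h
      refine ⟨i γ • v, h, fun δ hδ => ?_⟩
      rw [smul_smul, ← map_mul]
      exact hr _ (by rw [pow_succ']; exact Ideal.mul_mem_mul hδ hγ)

/-- Finiteness of the set of simple modules with a nonzero `m`-component. -/
theorem exists_finset_simple_hasWeight [IsNoetherianRing Γ]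
    (hV : ∀ u : Bimod i, ∃ V : Submodule (Γ ⊗[k] Γ) (Bimod i),
      u ∈ V ∧ IsFGAlong (inclLeft k) V ∧ IsFGAlong (inclRight k) V)
    {W : Submodule (Γ ⊗[k] Γ) (Bimod i)} (hW : IsFGAlong (inclLeft k) W)
    (hf : ∀ u : Bimod i, ∃ f : Γ ⊗[k] Γ, 1 - f ∈ biIdeal k m m ∧ f • u ∈ W) :
    ∃ s : Finset (Submodule U U), ∀ (N : Type*) [AddCommGroup N] [Module U N],
      IsSimpleModule U N → HasWeight i m N → ∃ P ∈ s, Nonempty (N ≃ₗ[U] U ⧸ P) := by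
  have := m.isMaximal
  let : Module Γ U := Module.compHom U (i : Γ →+* U)
  have : IsScalarTower Γ U U := ⟨fun γ x y => mul_assoc (i γ) x y⟩
  obtain ⟨r, s, -, hs⟩ := hW
  obtain ⟨T, hT⟩ := exists_finset_quotient_equiv (R := Γ) m.asIdeal (weightIdeal i m)
    (fun γ hγ => by
      change i γ * 1 ∈ _
      rw [mul_one]
      exact Submodule.subset_span ⟨γ, hγ, rfl⟩)
    (fun u => by
      obtain ⟨V, hu, hl, hr⟩ := hV ((Bimod.toRing i).symm u)
      exact exists_split_mod_weightIdeal hl hr hu)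
    (Submodule.span Γ (Set.range fun a => Bimod.toRing i (s a)))
    (Submodule.fg_span (Set.finite_range _))
    (by
      rintro u ⟨c, hc⟩
      obtain ⟨f, hf1, hfW⟩ := hf ((Bimod.toRing i).symm u)
      obtain ⟨w, hw, hwu⟩ := exists_sub_mem_weightSub hf1 hfW hc
      refine ⟨Bimod.toRing i w, ?_, hwu⟩
      obtain ⟨d, rfl⟩ := hs w hw
      rw [map_sum]
      refine sum_mem fun a _ => ?_
      rw [Bimod.toRing_inclLeft_smul]
      exact Submodule.smul_mem _ (d a) (Submodule.subset_span ⟨a, rfl⟩))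
  refine ⟨T, fun N _ _ hN hw => ?_⟩
  obtain ⟨v, hv, hvm⟩ := hw.exists_smul_eq_zero
  -- The annihilator of `v` is a maximal left ideal containing `U m`.
  let q : U →ₗ[U] N := LinearMap.toSpanSingleton U N v
  have hq : Function.Surjective q := IsSimpleModule.toSpanSingleton_surjective U hv
  have e := q.quotKerEquivOfSurjective hq
  have hco : IsCoatom q.ker := isSimpleModule_iff_isCoatom.1 (IsSimpleModule.congr e)
  obtain ⟨P, hP, ⟨e'⟩⟩ := hT q.ker hco (Submodule.span_le.2 (by
    rintro _ ⟨γ, hγ, rfl⟩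
    exact hvm γ hγ))
  exact ⟨P, hP, ⟨e.symm ≪≫ₗ e'⟩⟩

end Weight

end GaloisOrder

/-! ### Completions and the direct limit -/

/-- An element of `1 + I` acts surjectively on `I`-adic completions. -/
theorem AdicCompletion.exists_smul_eq_of_one_sub_mem {A V : Type*} [CommRing A] [AddCommGroup V]
    [Module A V] {I : Ideal A} {f : A} (hf : 1 - f ∈ I) (y : AdicCompletion I V) :
    ∃ x : AdicCompletion I V, f • x = y := by
  obtain ⟨y, rfl⟩ := AdicCompletion.mk_surjective I V y
  -- The truncated geometric series inverts `f` modulo `I ^ a`.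
  let g : ℕ → A := fun a => ∑ b ∈ Finset.range a, (1 - f) ^ b
  have hg (a) : f * g a = 1 - (1 - f) ^ a := by
    have := mul_neg_geom_sum (1 - f) a
    rwa [sub_sub_cancel] at this
  refine ⟨AdicCompletion.mk I V (AdicCompletion.AdicCauchySequence.mk I V (fun a => g a • y a)
    fun a => ?_), AdicCompletion.ext fun a => ?_⟩
  · rw [SModEq.sub_mem, show g (a + 1) = g a + (1 - f) ^ a from Finset.sum_range_succ _ _]
    have h1 : y a - y (a + 1) ∈ (I ^ a • ⊤ : Submodule A V) :=
      SModEq.sub_mem.1 (y.2 (Nat.le_succ a))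
    have h2 : (1 - f) ^ a • y (a + 1) ∈ (I ^ a • ⊤ : Submodule A V) :=
      Submodule.smul_mem_smul (Ideal.pow_mem_pow hf a) trivial
    have h3 : g a • y a - (g a + (1 - f) ^ a) • y (a + 1) =
        g a • (y a - y (a + 1)) - (1 - f) ^ a • y (a + 1) := by
      rw [add_smul, smul_sub]; abel
    rw [h3]
    exact sub_mem (Submodule.smul_mem _ _ h1) h2
  · change Submodule.Quotient.mk (f • g a • y a) = Submodule.Quotient.mk (y a)
    rw [Submodule.Quotient.eq, smul_smul, hg, sub_smul, one_smul, sub_sub_cancel_left]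
    exact neg_mem (Submodule.smul_mem_smul (Ideal.pow_mem_pow hf a) trivial)

theorem AdicCompletion.map_smul_id {A V W : Type*} [CommRing A] [AddCommGroup V]
    [Module A V] [AddCommGroup W] [Module A W] (I : Ideal A) (f : A) (h : V →ₗ[A] W)
    (x : AdicCompletion I V) :
    AdicCompletion.map I (f • h) x = AdicCompletion.map I h (f • x) := by
  obtain ⟨x, rfl⟩ := AdicCompletion.mk_surjective I V x
  rw [← map_smul, AdicCompletion.map_mk, AdicCompletion.map_mk]
  congr 1
  ext a
  exact (map_smul h f _).symm

namespace GaloisOrder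

section HomSpace

variable {k Γ U : Type*} [Field k] [CommRing Γ] [Algebra k Γ] [Ring U] [Algebra k U]
  (i : Γ →ₐ[k] U) (m n : MaximalSpectrum Γ)

theorem HomSpace.of_map {V W : FGSub i} (h : V ≤ W) (x : AdicCompletion (biIdeal k m n) V.1) :
    HomSpace.of i m n W (AdicCompletion.map (biIdeal k m n) (Submodule.inclusion h) x) =
      HomSpace.of i m n V x :=
  Module.DirectLimit.of_f

theorem HomSpace.of_of (V : FGSub i) (v : V.1) :
    HomSpace.of i m n V (AdicCompletion.of (biIdeal k m n) _ v) = HomSpace.ofElem i m n v := by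
  have h : (⟨Submodule.span _ {(v : Bimod i)}, Submodule.fg_span (Set.finite_singleton _)⟩ :
      FGSub i) ≤ V := Submodule.span_le.2 (Set.singleton_subset_iff.2 v.2)
  rw [HomSpace.ofElem, ← HomSpace.of_map i m n h, AdicCompletion.map_of]
  rfl

instance : Nonempty (FGSub i) := ⟨⟨⊥, Submodule.fg_bot⟩⟩

instance : IsDirectedOrder (FGSub i) :=
  ⟨fun V W => ⟨⟨V.1 ⊔ W.1, V.2.sup W.2⟩, le_sup_left (a := V.1), le_sup_right (a := V.1)⟩⟩

theorem HomSpace.exists_of (z : HomSpace i m n) :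
    ∃ (V : FGSub i) (x : AdicCompletion (biIdeal k m n) V.1), HomSpace.of i m n V x = z :=
  Module.DirectLimit.exists_of z

/-- If every finitely generated subbimodule is moved into `W` by some element of
`1 + n ⊗ Γ + Γ ⊗ m`, then the completion of `W` maps onto `𝒜(m, n)`. -/
theorem HomSpace.of_surjective (W : FGSub i)
    (hW : ∀ V : FGSub i, ∃ f : Γ ⊗[k] Γ, 1 - f ∈ biIdeal k m n ∧ ∀ v ∈ V.1, f • v ∈ W.1) :
    Function.Surjective (HomSpace.of i m n W) := by
  intro z
  obtain ⟨V, y, rfl⟩ := HomSpace.exists_of i m n z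
  obtain ⟨f, hf, hfW⟩ := hW V
  obtain ⟨x, rfl⟩ := AdicCompletion.exists_smul_eq_of_one_sub_mem hf y
  -- Inside `V + W`, this map is multiplication by `f`. Hence the image of `x` in the completion of
  -- `W` and `f x` in that of `V` define the same element of the limit.
  let g : V.1 →ₗ[Γ ⊗[k] Γ] W.1 := (f • V.1.subtype).codRestrict W.1 fun v => hfW v v.2
  let V' : FGSub i := ⟨V.1 ⊔ W.1, V.2.sup W.2⟩
  have hV : V ≤ V' := le_sup_left (a := V.1)
  have hWV : W ≤ V' := le_sup_right (a := V.1)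
  refine ⟨AdicCompletion.map _ g x, ?_⟩
  rw [← HomSpace.of_map i m n hV, ← HomSpace.of_map i m n hWV, AdicCompletion.map_comp_apply,
    ← AdicCompletion.map_smul_id]
  rfl

theorem HomSpace.exists_sum_smul_ofElem {R : Type*} [CommRing R] [IsNoetherianRing R] (J : Ideal R)
    [J.IsMaximal] (f : R →+* Γ ⊗[k] Γ) (h : J ≤ (biIdeal k m n).comap f) {W : FGSub i}
    (hW : Function.Surjective (HomSpace.of i m n W)) {r : ℕ} {s : Fin r → Bimod i}
    (hs : ∀ a, s a ∈ W.1) (hsW : ∀ x ∈ W.1, ∃ c : Fin r → R, x = ∑ a, f (c a) • s a)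
    (z : HomSpace i m n) : ∃ c : Fin r → AdicCompletion J R,
      z = ∑ a, completionMap J (biIdeal k m n) f h (c a) • HomSpace.ofElem i m n (s a) := by
  obtain ⟨x, rfl⟩ := hW z
  obtain ⟨c, rfl⟩ := exists_sum_completionMap_smul J (biIdeal k m n) f h
    (fun a => (⟨s a, hs a⟩ : W.1)) (fun x => by
      obtain ⟨c, hc⟩ := hsW x x.2
      exact ⟨c, Subtype.ext (by rw [hc]; simp)⟩) x
  refine ⟨c, ?_⟩
  rw [map_sum]
  exact Finset.sum_congr rfl fun a _ => by rw [map_smul, HomSpace.of_of]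

/-- The action of `Γ̂_n` factors through the completed `Γ ⊗ Γ`, so one finite generating set taken
from `W` serves all three claims. -/
theorem HomSpace.finite_biCompletion_and_left [IsNoetherianRing Γ] {W : FGSub i}
    (hW : Function.Surjective (HomSpace.of i m n W)) (hl : IsFGAlong (inclLeft k) W.1) :
    Module.Finite (BiCompletion k m n) (HomSpace i m n) ∧
    Module.Finite (AdicCompletion n.asIdeal Γ) (HomSpace i m n) ∧
    Submodule.span (AdicCompletion n.asIdeal Γ) (HomSpace.ofElem i m n '' W.1) = ⊤ := by
  obtain ⟨r, s, hs, hsW⟩ := hl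
  have := n.isMaximal
  have key := HomSpace.exists_sum_smul_ofElem i m n n.asIdeal (inclLeft k)
    (Ideal.le_comap_of_map_le le_sup_left) hW hs hsW
  refine ⟨⟨Submodule.fg_iff_exists_fin_generating_family.2 ⟨r,
      fun a => HomSpace.ofElem i m n (s a), top_le_iff.1 fun z _ => ?_⟩⟩,
    ⟨Submodule.fg_iff_exists_fin_generating_family.2 ⟨r,
      fun a => HomSpace.ofElem i m n (s a), top_le_iff.1 fun z _ => ?_⟩⟩,
    top_le_iff.1 fun z _ => ?_⟩
  · obtain ⟨c, rfl⟩ := key z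
    exact sum_mem fun a _ => Submodule.smul_mem _ _ (Submodule.subset_span ⟨a, rfl⟩)
  · obtain ⟨c, rfl⟩ := key z
    exact sum_mem fun a _ => Submodule.smul_mem _ (c a) (Submodule.subset_span ⟨a, rfl⟩)
  · obtain ⟨c, rfl⟩ := key z
    exact sum_mem fun a _ => Submodule.smul_mem _ (c a) (Submodule.subset_span ⟨s a, hs a, rfl⟩)

theorem HomSpace.finite_right [IsNoetherianRing Γ] {W : FGSub i}
    (hW : Function.Surjective (HomSpace.of i m n W)) (hr : IsFGAlong (inclRight k) W.1) :
    Module.Finite (AdicCompletion m.asIdeal Γ)ᵐᵒᵖ (HomSpace i m n) ∧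
    Submodule.span (AdicCompletion m.asIdeal Γ)ᵐᵒᵖ (HomSpace.ofElem i m n '' W.1) = ⊤ := by
  obtain ⟨r, s, hs, hsW⟩ := hr
  have := m.isMaximal
  have key := HomSpace.exists_sum_smul_ofElem i m n m.asIdeal (inclRight k)
    (Ideal.le_comap_of_map_le le_sup_right) hW hs hsW
  refine ⟨⟨Submodule.fg_iff_exists_fin_generating_family.2 ⟨r,
      fun a => HomSpace.ofElem i m n (s a), top_le_iff.1 fun z _ => ?_⟩⟩,
    top_le_iff.1 fun z _ => ?_⟩
  · obtain ⟨c, rfl⟩ := key z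
    exact sum_mem fun a _ =>
      Submodule.smul_mem _ (MulOpposite.op (c a)) (Submodule.subset_span ⟨a, rfl⟩)
  · obtain ⟨c, rfl⟩ := key z
    exact sum_mem fun a _ =>
      Submodule.smul_mem _ (MulOpposite.op (c a)) (Submodule.subset_span ⟨s a, hs a, rfl⟩)

end HomSpace

/-! ### Finiteness of `S(m, m)` -/

section LinkSet

variable {k L : Type*} [Field k] [Field L] [Algebra k L]
  {K : Type*} [Field K] [Algebra K L] [Algebra k K] [IsScalarTower k K L]
  {Γ : Type*} [CommRing Γ] [Algebra Γ L] {M : Submonoid (L ≃ₐ[k] L)}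

/-- If `S(m, n)` is finite and nonempty, then `S(m, m)` is finite. -/
theorem finite_linkSet_self [FiniteDimensional K L] (hconj : ConjClosed K M)
    {ℓm ℓn : MaximalSpectrum (integralClosure Γ L)} (hS : (linkSet K M ℓm ℓn).Finite)
    (hne : (linkSet K M ℓm ℓn).Nonempty) : (linkSet K M ℓm ℓm).Finite := by
  obtain ⟨ψ, h₁, h₂, hψ⟩ := hne
  -- If `φ g₁ ℓm = g₂ ℓm`, conjugating `φ` by `h₁ g₂⁻¹` makes its target `h₁ ℓm`, which `ψ` sends to
  -- `h₂ ℓn`. So `S(m, m)` is covered by finitely many preimages of `S(m, n)` under injective maps.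
  let F : (L ≃ₐ[K] L) → M → M := fun g φ => ψ * ⟨_, hconj (h₁ * g⁻¹) φ φ.2⟩
  have hF (g : L ≃ₐ[K] L) : Function.Injective (F g) := by
    intro φ χ h
    have h' : (ψ : L ≃ₐ[k] L) * (((h₁ * g⁻¹).restrictScalars k) * φ *
      ((h₁ * g⁻¹).restrictScalars k)⁻¹) = ψ * (((h₁ * g⁻¹).restrictScalars k) * χ *
      ((h₁ * g⁻¹).restrictScalars k)⁻¹) := congrArg Subtype.val h
    exact Subtype.ext (mul_left_cancel (mul_right_cancel (mul_left_cancel h')))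
  refine (Set.finite_iUnion fun g => hS.preimage (hF g).injOn).subset ?_
  rintro φ ⟨g₁, g₂, h⟩
  refine Set.mem_iUnion.2 ⟨g₂, h₁ * g₂⁻¹ * g₁, h₂, ?_⟩
  rw [← hψ]
  ext y
  constructor
  · rintro ⟨_, ⟨x, hx, rfl⟩, rfl⟩
    obtain ⟨z, hz, hz'⟩ := h.subset ⟨_, ⟨x, hx, rfl⟩, rfl⟩
    refine ⟨h₁ z, ⟨z, hz, rfl⟩, ?_⟩
    change (ψ : L ≃ₐ[k] L) (h₁ z) = (ψ : L ≃ₐ[k] L) (h₁ (g₂.symm ((φ : L ≃ₐ[k] L)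
      (g₂ (h₁.symm (h₁ (g₂.symm (g₁ x))))))))
    rw [AlgEquiv.symm_apply_apply, AlgEquiv.apply_symm_apply, ← hz', AlgEquiv.symm_apply_apply]
  · rintro ⟨_, ⟨z, hz, rfl⟩, rfl⟩
    obtain ⟨_, ⟨x, hx, rfl⟩, hx'⟩ := h.superset ⟨z, hz, rfl⟩
    refine ⟨_, ⟨x, hx, rfl⟩, ?_⟩
    change (ψ : L ≃ₐ[k] L) (h₁ (g₂.symm ((φ : L ≃ₐ[k] L)
      (g₂ (h₁.symm (h₁ (g₂.symm (g₁ x)))))))) = (ψ : L ≃ₐ[k] L) (h₁ z)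
    rw [AlgEquiv.symm_apply_apply, AlgEquiv.apply_symm_apply, hx', AlgEquiv.symm_apply_apply]

end LinkSet

end GaloisOrder

/-! ### The main theorem -/

set_option maxHeartbeats 1000000 in
open GaloisOrder in
theorem mainTheorem5 {k Γ K L : Type*} [Field k] [IsAlgClosed k] [CharZero k]
    [CommRing Γ] [IsDomain Γ] [IsNoetherianRing Γ] [IsIntegrallyClosed Γ] [Algebra k Γ]
    [Field K] [Algebra Γ K] [IsFractionRing Γ K] [Algebra k K] [IsScalarTower k Γ K]
    [Field L] [Algebra K L] [FiniteDimensional K L] [IsGalois K L]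
    [Algebra k L] [IsScalarTower k K L] [Algebra Γ L] [IsScalarTower Γ K L]
    [IsScalarTower k Γ L]
    (M : Submonoid (L ≃ₐ[k] L)) (hconj : ConjClosed K M) (hsep : Separating K M)
    (U : Subalgebra k (SkewMonoidAlgebra L M)) (hU : IsGaloisOrder K Γ M U)
    (m n : MaximalSpectrum Γ) (ℓm ℓn : MaximalSpectrum (integralClosure Γ L))
    (hm : ℓm.asIdeal.comap (algebraMap Γ (integralClosure Γ L)) = m.asIdeal)
    (hn : ℓn.asIdeal.comap (algebraMap Γ (integralClosure Γ L)) = n.asIdeal)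
    (hS : (linkSet K M ℓm ℓn).Finite) :
    -- `𝒜(m, n)` is finitely generated as a completed bimodule, on the left and on the right
    Module.Finite (BiCompletion k m n) (HomSpace hU.incl m n) ∧
    Module.Finite (AdicCompletion n.asIdeal Γ) (HomSpace hU.incl m n) ∧
    Module.Finite (AdicCompletion m.asIdeal Γ)ᵐᵒᵖ (HomSpace hU.incl m n) ∧
    -- `𝒜(m, n)` is the image of the completion of `U(S)`
    (∃ hfg : (supportSub hU.toIsGaloisRing (linkSet K M ℓm ℓn)).FG,
      Function.Surjective (HomSpace.of hU.incl m n ⟨_, hfg⟩)) ∧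
    -- the image of `U(S)` itself generates `𝒜(m, n)` on the left and on the right
    Submodule.span (AdicCompletion n.asIdeal Γ) (HomSpace.ofElem hU.incl m n ''
      (supportSub hU.toIsGaloisRing (linkSet K M ℓm ℓn) : Set (Bimod hU.incl))) = ⊤ ∧
    Submodule.span (AdicCompletion m.asIdeal Γ)ᵐᵒᵖ (HomSpace.ofElem hU.incl m n ''
      (supportSub hU.toIsGaloisRing (linkSet K M ℓm ℓn) : Set (Bimod hU.incl))) = ⊤ ∧
    -- if `S(m, n)` is nonempty (always so for `n = m`), then `Γ` is big in `m`, and there are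
    -- finitely many isomorphism classes of simple `U`-modules with a nonzero `m`-component
    ((linkSet K M ℓm ℓn).Nonempty → IsBig hU.incl m ∧
      ∃ s : Finset (Submodule U U), ∀ (N : Type*) [AddCommGroup N] [Module U N],
        IsSimpleModule U N → HasWeight hU.incl m N →
          ∃ P ∈ s, Nonempty (N ≃ₗ[U] U ⧸ P)) := by
  -- Stated for arbitrary `n`, since it is needed both for the pair `(m, n)` and for `(m, m)`.
  have main {n : MaximalSpectrum Γ} {ℓn : MaximalSpectrum (integralClosure Γ L)}
      (hn : ℓn.asIdeal.comap (algebraMap Γ (integralClosure Γ L)) = n.asIdeal)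
      (hS : (linkSet K M ℓm ℓn).Finite) :
      ∃ hfg : (supportSub hU.toIsGaloisRing (linkSet K M ℓm ℓn)).FG,
        Function.Surjective (HomSpace.of hU.incl m n ⟨_, hfg⟩) :=
    ⟨(isFGAlong_inclLeft_supportSub hU hS).fg, HomSpace.of_surjective _ _ _ _ fun V =>
      exists_smul_mem_supportSub hU hconj hm hn V.2⟩
  obtain ⟨hfg, hsurj⟩ := main hn hS
  obtain ⟨fin, finl, spanl⟩ := HomSpace.finite_biCompletion_and_left hU.incl m n hsurj
    (isFGAlong_inclLeft_supportSub hU hS)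
  obtain ⟨finr, spanr⟩ := HomSpace.finite_right hU.incl m n hsurj
    (isFGAlong_inclRight_supportSub hU hS)
  refine ⟨fin, finl, finr, ⟨hfg, hsurj⟩, spanl, spanr, fun hne => ?_⟩
  have hS' := finite_linkSet_self hconj hS hne
  obtain ⟨_, hsurj'⟩ := main hm hS'
  refine ⟨(HomSpace.finite_right hU.incl m m hsurj' (isFGAlong_inclRight_supportSub hU hS')).1,
    exists_finset_simple_hasWeight (fun u => ?_) (isFGAlong_inclLeft_supportSub hU hS') fun u => ?_⟩
  -- The bimodule generated by `u` need not obviously be finitely generated on each side; the larger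
  -- `U(T)` is.
  · obtain ⟨T, hT, h⟩ := exists_finite_le_supportSub hU.toIsGaloisRing
      (Submodule.fg_span (Set.finite_singleton u))
    exact ⟨_, h (Submodule.mem_span_singleton_self u), isFGAlong_inclLeft_supportSub hU hT,
      isFGAlong_inclRight_supportSub hU hT⟩
  · obtain ⟨f, hf, h⟩ := exists_smul_mem_supportSub hU hconj hm hm
      (Submodule.fg_span (Set.finite_singleton u))
    exact ⟨f, hf, h u (Submodule.mem_span_singleton_self u)⟩
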